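/- Let $1\le k<d\le n$ and let $X\in\mathbb R^{d\times n}$ have full SVD $X=U\Sigma V^\top$, with $U\in\mathbb R^{d\times d}$, $V\in\mathbb R^{n\times n}$ orthogonal and $\Sigma\in\mathbb R^{d\times n}$ having diagonal entries $\sigma_1\ge\sigma_2\ge\cdots\ge\sigma_d\ge 0$ and zeros elsewhere. For $Y\in\mathbb R^{d\times n}$ let $g_k(Y)$ denote the span of its $k$ leading principal components (orthonormal eigenvectors of $YY^\top$ belonging to the $k$ largest eigenvalues, ties being broken arbitrarily), and let $\theta(\cdot,\cdot)$ be the Asimov distance, i.e. the largest principal angle, between two $k$-dimensional subspaces of $\mathbb R^d$. Let $$0\le \eta<\frac{\sigma_k-\sigma_{k+1}}{\sqrt 2}.$$ Consider the attack problem of maximizing $\theta\big(g_k(X),g_k(X+\Delta X)\big)$ over all $\Delta X\in\mathbb R^{d\times n}$ with $\|\Delta X\|_F\le\eta$. Then: (i) $\Delta X$ is optimal for this problem if and only if $B=U^\top\Delta X\,V$ is optimal for $$\max_{B\in\mathbb R^{d\times n},\ \|B\|_F\le\eta}\ \theta\big(g_k(\Sigma),g_k(\Sigma+B)\big).\qquad(\ast)$$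 (ii) Problem $(\ast)$ has an optimal solution $B$ all of whose entries vanish, except possibly those at the positions $(k,k)$, $(k,k+1)$, $(k+1,k)$ and $(k+1,k+1)$. (iii) If $\sigma_k$ and $\sigma_{k+1}$ are simple, i.e. $\sigma_i\notin\{\sigma_k,\sigma_{k+1}\}$ for all $i\in\{1,\dots,d\}\setminus\{k,k+1\}$, then every optimal solution $B$ of $(\ast)$ has this form. -/

import Mathlib

-- In this file `‖M‖` for a matrix `M` is the Frobenius norm.
open scoped Matrix Matrix.Norms.Frobenius

noncomputable section

namespace SubspaceAttack

/-- The Gram matrix `X Xᵀ` acts as a symmetric operator on `ℝᵈ`. -/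
theorem gram_isSymmetric {d n : ℕ} (X : Matrix (Fin d) (Fin n) ℝ) :
    (Matrix.toEuclideanLin (X * Xᵀ)).IsSymmetric := by
  rw [Matrix.isSymmetric_toEuclideanLin_iff]
  simpa using Matrix.isHermitian_mul_conjTranspose_self X

/-- The principal components of the data matrix `X` (whose columns are the samples): an orthonormal
basis of `ℝᵈ` of eigenvectors of `X Xᵀ`, i.e. of left singular vectors of `X`, listed by
decreasing eigenvalue (Mathlib's `LinearMap.IsSymmetric.eigenvalues_antitone`). -/
def principalComponents {d n : ℕ} (X : Matrix (Fin d) (Fin n) ℝ) :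
    OrthonormalBasis (Fin d) ℝ (EuclideanSpace ℝ (Fin d)) :=
  (gram_isSymmetric X).eigenvectorBasis finrank_euclideanSpace_fin

/-- The subspace learned by PCA from `X`: the span of the `k` leading principal components. -/
def pcaSubspace {d n : ℕ} (k : ℕ) (X : Matrix (Fin d) (Fin n) ℝ) :
    Submodule ℝ (EuclideanSpace ℝ (Fin d)) :=
  Submodule.span ℝ (principalComponents X '' {i : Fin d | (i : ℕ) < k})

/-- `u, v` are principal vectors of the `k`-dimensional subspaces `P, Q`: recursively, `(u i, v i)`
maximizes the inner product over pairs of unit vectors in `P × Q` that are orthogonal to the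
previously chosen `u j`, respectively `v j`. -/
structure IsPrincipalVectors {d : ℕ} (k : ℕ) (P Q : Submodule ℝ (EuclideanSpace ℝ (Fin d)))
    (u v : Fin k → EuclideanSpace ℝ (Fin d)) : Prop where
  mem_left : ∀ i, u i ∈ P
  mem_right : ∀ i, v i ∈ Q
  norm_left : ∀ i, ‖u i‖ = 1
  norm_right : ∀ i, ‖v i‖ = 1
  orth_left : ∀ i j, j < i → inner ℝ (u j) (u i) = 0
  orth_right : ∀ i j, j < i → inner ℝ (v j) (v i) = 0
  isMax : ∀ i, ∀ x ∈ P, ∀ y ∈ Q, ‖x‖ = 1 → ‖y‖ = 1 →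
    (∀ j, j < i → inner ℝ (u j) x = 0) → (∀ j, j < i → inner ℝ (v j) y = 0) →
    inner ℝ x y ≤ inner ℝ (u i) (v i)

/-- The Asimov distance of two `k`-dimensional subspaces: the largest of their principal angles
`θ i = arccos ⟪u i, v i⟫`. -/
def asimovDist {d : ℕ} (k : ℕ) (P Q : Submodule ℝ (EuclideanSpace ℝ (Fin d))) : ℝ :=
  sSup {θ : ℝ | ∃ u v : Fin k → EuclideanSpace ℝ (Fin d), IsPrincipalVectors k P Q u v ∧
    ∃ i : Fin k, θ = Real.arccos (inner ℝ (u i) (v i))}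

/-- `D` solves: maximize the Asimov distance between the PCA subspaces of `X` and of `X + D`
subject to the energy constraint `‖D‖_F ≤ η`. -/
def IsOptimalAttack {d n : ℕ} (k : ℕ) (η : ℝ) (X D : Matrix (Fin d) (Fin n) ℝ) : Prop :=
  IsMaxOn (fun E : Matrix (Fin d) (Fin n) ℝ =>
    asimovDist k (pcaSubspace k X) (pcaSubspace k (X + E))) {E | ‖E‖ ≤ η} D ∧ ‖D‖ ≤ η

/-- The `d × n` matrix with `σ` on its main diagonal and zeros elsewhere. -/
def rectDiag {d : ℕ} (n : ℕ) (σ : Fin d → ℝ) : Matrix (Fin d) (Fin n) ℝ :=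
  Matrix.of fun i j => if (i : ℕ) = (j : ℕ) then σ i else 0

/-- Only the entries of `B` at the (1-based) positions `(k,k)`, `(k,k+1)`, `(k+1,k)`, `(k+1,k+1)`
may be nonzero; the 1-based indices `k`, `k+1` are the 0-based indices `k - 1`, `k`. -/
def SupportedOnBlock {d n : ℕ} (k : ℕ) (B : Matrix (Fin d) (Fin n) ℝ) : Prop :=
  ∀ i j, B i j ≠ 0 →
    ((i : ℕ) + 1 = k ∨ (i : ℕ) + 1 = k + 1) ∧ ((j : ℕ) + 1 = k ∨ (j : ℕ) + 1 = k + 1)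

end SubspaceAttack

end

/-!
Write `M = Σ + B`, let `P` be the span of the first `k` coordinate axes and put `a = σ_k`,
`b = σ_{k+1}`, `h = 2η²`.

*Stability.* If some unit vectors `x ∈ P`, `z ∈ Pᗮ` had `‖Mᵀ x‖ ≤ ‖Mᵀ z‖`, then
`‖Bᵀ x‖ + ‖Bᵀ z‖ ≥ a - b`, hence `‖B‖ ≥ (a - b) / √2`. So `M` separates `P` from `Pᗮ`
(`separates_rectDiag_add`), and by the Courant–Fischer principle its leading subspace is unique;
this gives the equivariance `pcaSubspace_mul_mul_transpose` behind the first claim.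

*Upper bound.* The last pair of principal vectors `u ∈ P`, `v ∈ Q` of `P` and the perturbed subspace
`Q` is stationary (`exists_asimovDist_eq_arccos`), so with `c = ⟪u, v⟫` there are unit vectors
`z ∈ Pᗮ`, `w ∈ Qᗮ` with `v = c u + s z`, `w = c z - s u`. Separation forces `s < c`. Since `Q` is
spanned by left singular vectors, `Mᵀ v ⟂ Mᵀ w`, i.e. `Mᵀ (v + w)` and `Mᵀ (v - w)` have equal
length. Making the vectors `Σᵀ (v ± w)`, of lengths `r₁`, `r₂`, equally long costs
`(r₂ - r₁)² ≤ 4 ‖B‖²`, which in terms of `x = ‖Σᵀ u‖² ≥ a²` and `y = ‖Σᵀ z‖² ≤ b²` reads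
`4 c² s² (x - y)² ≤ h (2 (x + y) - h)` (`tilt_bound`). The quotient
`(2 (x + y) - h) / (x - y)²` is largest at `x = a²`, `y = b²` (`gap_comparison`), so that
`sin² 2θ ≤ extremalSinSq a b h` for the Asimov distance `θ = arccos c < π / 4`.

*Equality.* Rescaling the two vectors `Σᵀ (v ± w)` for `u = e_k`, `z = e_{k+1}` to their mean length
attains the bound, by a perturbation inside the `2 × 2` block
(`exists_supportedOnBlock_asimovDist_ge`). Conversely, equality forces `‖Σᵀ u‖ = a` and
`‖Σᵀ z‖ = b`, which for simple `a` and `b` means `u = ±e_k`, `z = ±e_{k+1}`; it forces all of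
`‖B‖²` to be spent on the rows `Bᵀ u`, `Bᵀ z`, and these to lie in the span of `Σᵀ u`, `Σᵀ z`.
-/

namespace SubspaceAttack

open Module

/-! ### Spans of parts of an orthonormal basis -/

section Spans

variable {E : Type*} [NormedAddCommGroup E] [InnerProductSpace ℝ E]

theorem mem_orthogonal_span_image {ι : Type*} (b : ι → E) (s : Set ι) (x : E) :
    x ∈ (Submodule.span ℝ (b '' s))ᗮ ↔ ∀ i ∈ s, inner ℝ (b i) x = 0 := by
  rw [Submodule.mem_orthogonal]
  refine ⟨fun h i hi => h _ (Submodule.subset_span ⟨i, hi, rfl⟩), fun h u hu => ?_⟩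
  induction hu using Submodule.span_induction with
  | mem y hy => obtain ⟨i, hi, rfl⟩ := hy; exact h i hi
  | zero => simp
  | add y z _ _ hy hz => rw [inner_add_left, hy, hz, add_zero]
  | smul a y _ hy => rw [inner_smul_left, hy, mul_zero]

theorem mem_span_image_iff_inner {ι : Type*} [Fintype ι] (b : OrthonormalBasis ι ℝ E)
    (s : Set ι) (x : E) :
    x ∈ Submodule.span ℝ (b '' s) ↔ ∀ i, i ∉ s → inner ℝ (b i) x = 0 := by
  refine ⟨fun hx i hi => ?_, fun h => ?_⟩
  · have : b i ∈ (Submodule.span ℝ (b '' s))ᗮ := by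
      rw [mem_orthogonal_span_image]
      intro j hj
      exact b.orthonormal.2 (fun h => hi (h ▸ hj))
    rw [real_inner_comm]
    exact this x hx
  · rw [← b.sum_repr' x]
    refine Submodule.sum_mem _ fun i _ => ?_
    by_cases hi : i ∈ s
    · exact Submodule.smul_mem _ _ (Submodule.subset_span ⟨i, hi, rfl⟩)
    · rw [h i hi, zero_smul]; exact Submodule.zero_mem _

theorem finrank_span_image {ι : Type*} [Fintype ι] (b : OrthonormalBasis ι ℝ E) (s : Set ι) :
    finrank ℝ (Submodule.span ℝ (b '' s)) = s.ncard := by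
  classical
  have h : LinearIndependent ℝ (fun i : s => b i) :=
    b.orthonormal.linearIndependent.comp _ Subtype.val_injective
  rw [Set.image_eq_range, finrank_span_eq_card h, ← Nat.card_coe_set_eq, Nat.card_eq_fintype_card]

/-- Subspaces whose dimensions add up to more than the dimension of the space share a unit
vector. -/
theorem exists_unit_mem_of_finrank_lt [FiniteDimensional ℝ E] (S T : Submodule ℝ E)
    (h : finrank ℝ E < finrank ℝ S + finrank ℝ T) : ∃ x ∈ S, x ∈ T ∧ ‖x‖ = 1 := by
  have h1 := Submodule.finrank_sup_add_finrank_inf_eq S T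
  have h2 := Submodule.finrank_le (S ⊔ T)
  have h3 : S ⊓ T ≠ ⊥ := by
    intro h0
    rw [h0, finrank_bot] at h1
    omega
  obtain ⟨x, hx, hx0⟩ := Submodule.exists_mem_ne_zero_of_ne_bot h3
  have hx' := Submodule.mem_inf.1 hx
  exact ⟨‖x‖⁻¹ • x, S.smul_mem _ hx'.1, T.smul_mem _ hx'.2, norm_smul_inv_norm hx0⟩

end Spans

theorem ncard_setOf_val_lt {d m : ℕ} (h : m ≤ d) : {i : Fin d | (i : ℕ) < m}.ncard = m := by
  have : {i : Fin d | (i : ℕ) < m} = Set.range (Fin.castLE h) := by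
    ext i
    simp only [Set.mem_ofPred_eq, Set.mem_range]
    exact ⟨fun hi => ⟨⟨i, hi⟩, rfl⟩, fun ⟨j, hj⟩ => hj ▸ j.2⟩
  rw [this, Set.ncard_range_of_injective (Fin.castLE_injective h), Nat.card_fin]

theorem ncard_setOf_le_val {d m : ℕ} (h : m ≤ d) :
    {i : Fin d | m ≤ (i : ℕ)}.ncard = d - m := by
  have h1 : {i : Fin d | m ≤ (i : ℕ)} = {i : Fin d | (i : ℕ) < m}ᶜ := by ext; simp
  rw [h1, Set.ncard_compl, ncard_setOf_val_lt h, Nat.card_fin]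

/-! ### The leading left singular subspace -/

/-- The map `y ↦ Mᵀ y`; its right singular vectors are the principal components of `M`. -/
noncomputable def act {d n : ℕ} (M : Matrix (Fin d) (Fin n) ℝ) :
    EuclideanSpace ℝ (Fin d) →ₗ[ℝ] EuclideanSpace ℝ (Fin n) :=
  Matrix.toEuclideanLin Mᵀ

section PCA

variable {d n : ℕ}

theorem act_apply (M : Matrix (Fin d) (Fin n) ℝ) (y : EuclideanSpace ℝ (Fin d)) (j : Fin n) :
    act M y j = ∑ i, M i j * y i := by
  simp [act, Matrix.toLpLin_apply, Matrix.mulVec, dotProduct]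

theorem act_add_left (M N : Matrix (Fin d) (Fin n) ℝ) (y : EuclideanSpace ℝ (Fin d)) :
    act (M + N) y = act M y + act N y := by
  simp [act, Matrix.transpose_add, map_add]

theorem inner_toEuclideanLin (A : Matrix (Fin d) (Fin n) ℝ) (x : EuclideanSpace ℝ (Fin n))
    (y : EuclideanSpace ℝ (Fin d)) :
    inner ℝ (Matrix.toEuclideanLin A x) y = inner ℝ x (act A y) := by
  have h := Matrix.toEuclideanLin_conjTranspose_eq_adjoint A
  rw [Matrix.conjTranspose_eq_transpose_of_trivial] at h
  rw [act, h, LinearMap.adjoint_inner_right]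

theorem inner_gram (M : Matrix (Fin d) (Fin n) ℝ) (x y : EuclideanSpace ℝ (Fin d)) :
    inner ℝ (Matrix.toEuclideanLin (M * Mᵀ) x) y = inner ℝ (act M x) (act M y) := by
  rw [Matrix.toLpLin_mul_same, LinearMap.comp_apply, inner_toEuclideanLin]; rfl

/-- The eigenvalues of `M Mᵀ`, in decreasing order. -/
noncomputable def gramEigenvalues (M : Matrix (Fin d) (Fin n) ℝ) : Fin d → ℝ :=
  (gram_isSymmetric M).eigenvalues finrank_euclideanSpace_fin

theorem gramEigenvalues_antitone (M : Matrix (Fin d) (Fin n) ℝ) : Antitone (gramEigenvalues M) :=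
  (gram_isSymmetric M).eigenvalues_antitone _

theorem gram_principalComponents (M : Matrix (Fin d) (Fin n) ℝ) (i : Fin d) :
    Matrix.toEuclideanLin (M * Mᵀ) (principalComponents M i)
      = gramEigenvalues M i • principalComponents M i :=
  (gram_isSymmetric M).apply_eigenvectorBasis _ i

theorem inner_act_act (M : Matrix (Fin d) (Fin n) ℝ) (x y : EuclideanSpace ℝ (Fin d)) :
    inner ℝ (act M x) (act M y) = ∑ i, gramEigenvalues M i *
      (inner ℝ (principalComponents M i) x * inner ℝ (principalComponents M i) y) := by
  rw [← inner_gram, ← (principalComponents M).sum_inner_mul_inner]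
  refine Finset.sum_congr rfl fun i _ => ?_
  rw [gram_isSymmetric M, gram_principalComponents, inner_smul_right, real_inner_comm x]
  ring

theorem sq_norm_act (M : Matrix (Fin d) (Fin n) ℝ) (x : EuclideanSpace ℝ (Fin d)) :
    ‖act M x‖ ^ 2 = ∑ i, gramEigenvalues M i * inner ℝ (principalComponents M i) x ^ 2 := by
  rw [← real_inner_self_eq_norm_sq, inner_act_act]
  simp only [sq]

theorem mem_pcaSubspace (k : ℕ) (M : Matrix (Fin d) (Fin n) ℝ) (x : EuclideanSpace ℝ (Fin d)) :
    x ∈ pcaSubspace k M ↔ ∀ i : Fin d, k ≤ i → inner ℝ (principalComponents M i) x = 0 := by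
  rw [pcaSubspace, mem_span_image_iff_inner]
  simp

theorem mem_pcaSubspace_orthogonal (k : ℕ) (M : Matrix (Fin d) (Fin n) ℝ)
    (x : EuclideanSpace ℝ (Fin d)) :
    x ∈ (pcaSubspace k M)ᗮ ↔
      ∀ i : Fin d, (i : ℕ) < k → inner ℝ (principalComponents M i) x = 0 := by
  rw [pcaSubspace, mem_orthogonal_span_image]
  simp

theorem finrank_pcaSubspace {k : ℕ} (hk : k ≤ d) (M : Matrix (Fin d) (Fin n) ℝ) :
    finrank ℝ (pcaSubspace k M) = k := by
  rw [pcaSubspace, finrank_span_image, ncard_setOf_val_lt hk]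

theorem inner_act_act_eq_zero {k : ℕ} {M : Matrix (Fin d) (Fin n) ℝ}
    {y w : EuclideanSpace ℝ (Fin d)} (hy : y ∈ pcaSubspace k M) (hw : w ∈ (pcaSubspace k M)ᗮ) :
    inner ℝ (act M y) (act M w) = 0 := by
  rw [mem_pcaSubspace] at hy
  rw [mem_pcaSubspace_orthogonal] at hw
  rw [inner_act_act]
  refine Finset.sum_eq_zero fun i _ => ?_
  rcases lt_or_ge (i : ℕ) k with h | h
  · rw [hw i h]; ring
  · rw [hy i h]; ring

theorem sq_norm_act_le {M : Matrix (Fin d) (Fin n) ℝ} {x : EuclideanSpace ℝ (Fin d)} {l : ℝ}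
    (hx : ‖x‖ = 1)
    (h : ∀ i, inner ℝ (principalComponents M i) x ≠ 0 → gramEigenvalues M i ≤ l) :
    ‖act M x‖ ^ 2 ≤ l := by
  have h1 : ∑ i, inner ℝ (principalComponents M i) x ^ 2 = 1 := by
    have := (principalComponents M).sum_sq_norm_inner_right x
    simpa [hx] using this
  rw [sq_norm_act, ← mul_one l, ← h1, Finset.mul_sum]
  refine Finset.sum_le_sum fun i _ => ?_
  by_cases h0 : inner ℝ (principalComponents M i) x = 0
  · simp [h0]
  · exact mul_le_mul_of_nonneg_right (h i h0) (sq_nonneg _)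

theorem le_sq_norm_act {M : Matrix (Fin d) (Fin n) ℝ} {x : EuclideanSpace ℝ (Fin d)} {l : ℝ}
    (hx : ‖x‖ = 1)
    (h : ∀ i, inner ℝ (principalComponents M i) x ≠ 0 → l ≤ gramEigenvalues M i) :
    l ≤ ‖act M x‖ ^ 2 := by
  have h1 : ∑ i, inner ℝ (principalComponents M i) x ^ 2 = 1 := by
    have := (principalComponents M).sum_sq_norm_inner_right x
    simpa [hx] using this
  rw [sq_norm_act, ← mul_one l, ← h1, Finset.mul_sum]
  refine Finset.sum_le_sum fun i _ => ?_
  by_cases h0 : inner ℝ (principalComponents M i) x = 0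
  · simp [h0]
  · exact mul_le_mul_of_nonneg_right (h i h0) (sq_nonneg _)

theorem norm_act_le_norm_act {k : ℕ} (hkd : k < d) {M : Matrix (Fin d) (Fin n) ℝ}
    {y w : EuclideanSpace ℝ (Fin d)} (hy : y ∈ pcaSubspace k M) (hw : w ∈ (pcaSubspace k M)ᗮ)
    (hy1 : ‖y‖ = 1) (hw1 : ‖w‖ = 1) : ‖act M w‖ ≤ ‖act M y‖ := by
  rw [mem_pcaSubspace] at hy
  rw [mem_pcaSubspace_orthogonal] at hw
  rw [← sq_le_sq₀ (norm_nonneg _) (norm_nonneg _)]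
  refine (sq_norm_act_le (l := gramEigenvalues M ⟨k, hkd⟩) hw1 fun i hi => ?_).trans
    (le_sq_norm_act hy1 fun i hi => ?_)
  · refine gramEigenvalues_antitone M (Fin.le_def.2 ?_)
    by_contra! h
    exact hi (hw i h)
  · refine gramEigenvalues_antitone M (Fin.le_def.2 ?_)
    by_contra! h
    exact hi (hy i h.le)

/-- One half of the Courant–Fischer principle: any `P` of dimension `k` has a unit vector at which
`‖Mᵀ x‖²` is at most the `k`-th eigenvalue of `M Mᵀ`. -/
theorem exists_sq_norm_act_le {k : ℕ} (hk : 1 ≤ k) (hkd : k < d) (M : Matrix (Fin d) (Fin n) ℝ)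
    {P : Submodule ℝ (EuclideanSpace ℝ (Fin d))} (hP : finrank ℝ P = k) :
    ∃ x ∈ P, ‖x‖ = 1 ∧ ‖act M x‖ ^ 2 ≤ gramEigenvalues M ⟨k - 1, Nat.sub_lt_of_lt hkd⟩ := by
  obtain ⟨x, hxP, hx, hx1⟩ := exists_unit_mem_of_finrank_lt P
    (Submodule.span ℝ (principalComponents M '' {i : Fin d | k - 1 ≤ (i : ℕ)})) (by
      rw [finrank_span_image, ncard_setOf_le_val (by omega), hP, finrank_euclideanSpace_fin]; omega)
  refine ⟨x, hxP, hx1, sq_norm_act_le hx1 fun i hi => ?_⟩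
  rw [mem_span_image_iff_inner] at hx
  refine gramEigenvalues_antitone M (Fin.le_def.2 ?_)
  by_contra! h
  exact hi (hx i (not_le.2 h))

/-- The other half of the Courant–Fischer principle: the orthogonal complement of any `P` of
dimension `k` has a unit vector at which `‖Mᵀ z‖²` is at least the `(k+1)`-st eigenvalue of
`M Mᵀ`. -/
theorem exists_le_sq_norm_act {k : ℕ} (hkd : k < d) (M : Matrix (Fin d) (Fin n) ℝ)
    {P : Submodule ℝ (EuclideanSpace ℝ (Fin d))} (hP : finrank ℝ P = k) :
    ∃ z ∈ Pᗮ, ‖z‖ = 1 ∧ gramEigenvalues M ⟨k, hkd⟩ ≤ ‖act M z‖ ^ 2 := by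
  have hPo := P.finrank_add_finrank_orthogonal
  rw [finrank_euclideanSpace_fin] at hPo
  obtain ⟨x, hxP, hx, hx1⟩ := exists_unit_mem_of_finrank_lt Pᗮ
    (Submodule.span ℝ (principalComponents M '' {i : Fin d | (i : ℕ) < k + 1})) (by
      rw [finrank_span_image, ncard_setOf_val_lt (by omega), finrank_euclideanSpace_fin]; omega)
  refine ⟨x, hxP, hx1, le_sq_norm_act hx1 fun i hi => ?_⟩
  rw [mem_span_image_iff_inner] at hx
  refine gramEigenvalues_antitone M (Fin.le_def.2 ?_)
  by_contra! h
  exact hi (hx i (by rw [Set.mem_ofPred_eq, not_lt]; exact h))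

/-- An eigenvector of `M Mᵀ` lies in the leading subspace as soon as its eigenvalue exceeds
`‖Mᵀ z‖²` for the unit vectors `z` orthogonal to some `k`-dimensional `P`. -/
theorem mem_pcaSubspace_of_gram_eq_smul {k : ℕ} (hkd : k < d) {M : Matrix (Fin d) (Fin n) ℝ}
    {P : Submodule ℝ (EuclideanSpace ℝ (Fin d))} (hP : finrank ℝ P = k)
    {v : EuclideanSpace ℝ (Fin d)} {l : ℝ} (hv : Matrix.toEuclideanLin (M * Mᵀ) v = l • v)
    (hl : ∀ z ∈ Pᗮ, ‖z‖ = 1 → ‖act M z‖ ^ 2 < l) : v ∈ pcaSubspace k M := by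
  rw [mem_pcaSubspace]
  intro i hi
  obtain ⟨z, hz, hz1, hkz⟩ := exists_le_sq_norm_act hkd M hP
  have h1 : gramEigenvalues M i < l :=
    ((gramEigenvalues_antitone M (Fin.le_def.2 hi : (⟨k, hkd⟩ : Fin d) ≤ i)).trans hkz).trans_lt
      (hl z hz hz1)
  have h2 := gram_isSymmetric M (principalComponents M i) v
  rw [hv, gram_principalComponents, inner_smul_left, inner_smul_right] at h2
  have h3 : (gramEigenvalues M i - l) * inner ℝ (principalComponents M i) v = 0 := by
    simp only [conj_trivial] at h2
    linear_combination h2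
  exact (mul_eq_zero.1 h3).resolve_left (by linarith)

/-- `M` separates `P` from its orthogonal complement: `‖Mᵀ x‖` is larger on unit vectors of `P`
than on unit vectors of `Pᗮ`. -/
def Separates (M : Matrix (Fin d) (Fin n) ℝ) (P : Submodule ℝ (EuclideanSpace ℝ (Fin d))) : Prop :=
  ∀ x ∈ P, ∀ z ∈ Pᗮ, ‖x‖ = 1 → ‖z‖ = 1 → ‖act M z‖ < ‖act M x‖

end PCA

/-! ### Principal vectors and the Asimov distance -/

/-- First-order condition for a maximizer `u` of a linear functional on the unit sphere of `S`. -/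
theorem inner_eq_zero_of_forall_le {E : Type*} [NormedAddCommGroup E] [InnerProductSpace ℝ E]
    {S : Submodule ℝ E} {u v x : E} (hu : u ∈ S) (hu1 : ‖u‖ = 1) (hx : x ∈ S)
    (hux : inner ℝ u x = 0)
    (hmax : ∀ y ∈ S, ‖y‖ = 1 → inner ℝ y v ≤ inner ℝ u v) : inner ℝ x v = 0 := by
  by_contra h0
  have hx0 : x ≠ 0 := by rintro rfl; simp at h0
  -- reduce to a unit vector `e`, and test the maximality with the direction of `a u + b e`
  obtain ⟨e, he, he1, hue, hev⟩ : ∃ e ∈ S, ‖e‖ = 1 ∧ inner ℝ u e = 0 ∧ inner ℝ e v ≠ 0 := by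
    refine ⟨‖x‖⁻¹ • x, S.smul_mem _ hx, norm_smul_inv_norm hx0, ?_, ?_⟩
    · rw [inner_smul_right, hux, mul_zero]
    · rw [inner_smul_left]
      simp [hx0, h0]
  set a := inner ℝ u v
  set b := inner ℝ e v
  have hpos : 0 < a ^ 2 + b ^ 2 := by positivity
  have hn : ‖a • u + b • e‖ ^ 2 = a ^ 2 + b ^ 2 := by
    rw [norm_add_sq_real, norm_smul, norm_smul, inner_smul_left, inner_smul_right, hue, hu1, he1]
    simp
  have hn0 : 0 < ‖a • u + b • e‖ := by
    rcases (norm_nonneg (a • u + b • e)).eq_or_lt with h | h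
    · rw [← h] at hn; norm_num at hn; linarith
    · exact h
  have h1 := hmax (‖a • u + b • e‖⁻¹ • (a • u + b • e))
    (S.smul_mem _ (S.add_mem (S.smul_mem _ hu) (S.smul_mem _ he)))
    (norm_smul_inv_norm (norm_pos_iff.1 hn0))
  rw [inner_smul_left, inner_add_left, inner_smul_left, inner_smul_left] at h1
  simp only [conj_trivial] at h1
  change _ * (a * a + b * b) ≤ a at h1
  rw [show a * a + b * b = ‖a • u + b • e‖ ^ 2 by rw [hn]; ring, sq, inv_mul_cancel_left₀ hn0.ne']
    at h1
  nlinarith [sq_pos_of_ne_zero hev]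

variable {d k : ℕ} {P Q : Submodule ℝ (EuclideanSpace ℝ (Fin d))}

theorem IsPrincipalVectors.orthonormal_left {u v : Fin k → EuclideanSpace ℝ (Fin d)}
    (h : IsPrincipalVectors k P Q u v) : Orthonormal ℝ u := by
  refine ⟨h.norm_left, fun i j hij => ?_⟩
  rcases lt_or_gt_of_ne hij with hlt | hlt
  · exact h.orth_left j i hlt
  · rw [real_inner_comm]; exact h.orth_left i j hlt

theorem IsPrincipalVectors.symm {u v : Fin k → EuclideanSpace ℝ (Fin d)}
    (h : IsPrincipalVectors k P Q u v) : IsPrincipalVectors k Q P v u where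
  mem_left := h.mem_right
  mem_right := h.mem_left
  norm_left := h.norm_right
  norm_right := h.norm_left
  orth_left := h.orth_right
  orth_right := h.orth_left
  isMax i x hx y hy hx1 hy1 hxo hyo := by
    rw [real_inner_comm, real_inner_comm (u i)]
    exact h.isMax i y hy x hx hy1 hx1 hyo hxo

/-- Stationarity of the `i`-th pair: principal vectors with different indices are orthogonal across
the two subspaces. -/
theorem IsPrincipalVectors.inner_eq_zero_of_lt {u v : Fin k → EuclideanSpace ℝ (Fin d)}
    (h : IsPrincipalVectors k P Q u v) {i j : Fin k} (hij : i < j) :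
    inner ℝ (u j) (v i) = 0 := by
  have hmem : ∀ x, x ∈ P ⊓ (Submodule.span ℝ (u '' {l | l < i}))ᗮ ↔
      x ∈ P ∧ ∀ l, l < i → inner ℝ (u l) x = 0 := by
    intro x
    rw [Submodule.mem_inf, mem_orthogonal_span_image]; rfl
  refine inner_eq_zero_of_forall_le (S := P ⊓ (Submodule.span ℝ (u '' {l | l < i}))ᗮ)
    ((hmem _).2 ⟨h.mem_left i, h.orth_left i⟩) (h.norm_left i)
    ((hmem _).2 ⟨h.mem_left j, fun l hl => h.orth_left j l (hl.trans hij)⟩)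
    (h.orth_left j i hij) fun y hy hy1 => ?_
  rw [hmem] at hy
  exact h.isMax i y hy.1 (v i) (h.mem_right i) hy1 (h.norm_right i) hy.2 (h.orth_right i)

theorem IsPrincipalVectors.inner_eq_zero {u v : Fin k → EuclideanSpace ℝ (Fin d)}
    (h : IsPrincipalVectors k P Q u v) {i j : Fin k} (hij : i ≠ j) :
    inner ℝ (u i) (v j) = 0 := by
  rcases lt_or_gt_of_ne hij with hlt | hlt
  · rw [real_inner_comm]; exact h.symm.inner_eq_zero_of_lt hlt
  · exact h.inner_eq_zero_of_lt hlt

theorem IsPrincipalVectors.inner_nonneg {u v : Fin k → EuclideanSpace ℝ (Fin d)}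
    (h : IsPrincipalVectors k P Q u v) (i : Fin k) : 0 ≤ inner ℝ (u i) (v i) := by
  have := h.isMax i (u i) (h.mem_left i) (-v i) (Q.neg_mem (h.mem_right i)) (h.norm_left i)
    (by rw [norm_neg, h.norm_right i]) (h.orth_left i)
    (fun j hj => by rw [inner_neg_right, h.orth_right i j hj, neg_zero])
  rw [inner_neg_right] at this
  linarith

theorem IsPrincipalVectors.inner_antitone {u v : Fin k → EuclideanSpace ℝ (Fin d)}
    (h : IsPrincipalVectors k P Q u v) {i j : Fin k} (hij : i ≤ j) :
    inner ℝ (u j) (v j) ≤ inner ℝ (u i) (v i) :=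
  h.isMax i (u j) (h.mem_left j) (v j) (h.mem_right j) (h.norm_left j) (h.norm_right j)
    (fun l hl => h.orth_left j l (hl.trans_le hij)) (fun l hl => h.orth_right j l (hl.trans_le hij))

theorem IsPrincipalVectors.exists_sum_eq {u v : Fin k → EuclideanSpace ℝ (Fin d)}
    (h : IsPrincipalVectors k P Q u v) (hP : finrank ℝ P = k)
    {x : EuclideanSpace ℝ (Fin d)} (hx : x ∈ P) : ∃ c : Fin k → ℝ, ∑ i, c i • u i = x := by
  have h1 : Submodule.span ℝ (Set.range u) = P := by
    refine Submodule.eq_of_le_of_finrank_eq (Submodule.span_le.2 ?_) ?_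
    · rintro _ ⟨i, rfl⟩; exact h.mem_left i
    · rw [finrank_span_eq_card h.orthonormal_left.linearIndependent, hP, Fintype.card_fin]
  rw [← h1] at hx
  exact (Submodule.mem_span_range_iff_exists_fun ℝ).1 hx

theorem IsPrincipalVectors.inner_left {u v : Fin k → EuclideanSpace ℝ (Fin d)}
    (h : IsPrincipalVectors k P Q u v) (hP : finrank ℝ P = k)
    {x : EuclideanSpace ℝ (Fin d)} (hx : x ∈ P) (i : Fin k) :
    inner ℝ (v i) x = inner ℝ (u i) (v i) * inner ℝ (u i) x := by
  obtain ⟨c, rfl⟩ := h.exists_sum_eq hP hx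
  rw [h.orthonormal_left.inner_right_fintype, inner_sum, Finset.sum_eq_single i]
  · rw [inner_smul_right, real_inner_comm]; ring
  · intro j _ hj
    rw [inner_smul_right, real_inner_comm, h.inner_eq_zero hj, mul_zero]
  · simp

/-- The smallest principal cosine bounds from below how well a unit vector of `Q` can be matched
by a unit vector of `P`: `∑ cⱼ vⱼ` is matched by `∑ cⱼ uⱼ`. -/
theorem IsPrincipalVectors.exists_le_inner {u v : Fin k → EuclideanSpace ℝ (Fin d)}
    (h : IsPrincipalVectors k P Q u v) (hQ : finrank ℝ Q = k) {y : EuclideanSpace ℝ (Fin d)}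
    (hy : y ∈ Q) (hy1 : ‖y‖ = 1) {s : ℝ} (hs : ∀ i, s ≤ inner ℝ (u i) (v i)) :
    ∃ x ∈ P, ‖x‖ = 1 ∧ s ≤ inner ℝ x y := by
  obtain ⟨c, rfl⟩ := h.symm.exists_sum_eq hQ hy
  have hnorm : ∀ w : Fin k → EuclideanSpace ℝ (Fin d), Orthonormal ℝ w →
      ‖∑ i, c i • w i‖ ^ 2 = ∑ i, c i ^ 2 := by
    intro w hw
    rw [← real_inner_self_eq_norm_sq, hw.inner_sum]
    simp [sq]
  have hc : ∑ i, c i ^ 2 = 1 := by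
    rw [← hnorm v h.symm.orthonormal_left, hy1, one_pow]
  refine ⟨∑ i, c i • u i, P.sum_mem fun i _ => P.smul_mem _ (h.mem_left i), ?_, ?_⟩
  · rw [← sq_eq_sq₀ (norm_nonneg _) zero_le_one, hnorm u h.orthonormal_left, hc, one_pow]
  · have : inner ℝ (∑ i, c i • u i) (∑ i, c i • v i) = ∑ i, c i ^ 2 * inner ℝ (u i) (v i) := by
      rw [sum_inner]
      refine Finset.sum_congr rfl fun i _ => ?_
      rw [inner_smul_left, inner_sum, Finset.sum_eq_single i]
      · rw [inner_smul_right]; simp only [conj_trivial]; ring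
      · intro j _ hj
        rw [inner_smul_right, h.inner_eq_zero hj.symm, mul_zero]
      · simp
    rw [this, ← one_mul s, ← hc, Finset.sum_mul]
    exact Finset.sum_le_sum fun i _ => mul_le_mul_of_nonneg_left (hs i) (sq_nonneg _)

/-- One step of the recursion that defines principal vectors, by compactness of the unit spheres. -/
theorem exists_isMax_inner {m : ℕ} (hP : m < finrank ℝ P) (hQ : m < finrank ℝ Q)
    (u v : Fin m → EuclideanSpace ℝ (Fin d)) :
    ∃ x ∈ P, ∃ y ∈ Q, ‖x‖ = 1 ∧ ‖y‖ = 1 ∧ (∀ j, inner ℝ (u j) x = 0) ∧ (∀ j, inner ℝ (v j) y = 0) ∧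
      ∀ x' ∈ P, ∀ y' ∈ Q, ‖x'‖ = 1 → ‖y'‖ = 1 → (∀ j, inner ℝ (u j) x' = 0) →
        (∀ j, inner ℝ (v j) y' = 0) → inner ℝ x' y' ≤ inner ℝ x y := by
  have key : ∀ (R : Submodule ℝ (EuclideanSpace ℝ (Fin d))) (w : Fin m → EuclideanSpace ℝ (Fin d)),
      m < finrank ℝ R →
      IsCompact {x | x ∈ R ∧ ‖x‖ = 1 ∧ ∀ j, inner ℝ (w j) x = 0} ∧
      {x | x ∈ R ∧ ‖x‖ = 1 ∧ ∀ j, inner ℝ (w j) x = 0}.Nonempty := by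
    intro R w hR
    constructor
    · refine (isCompact_sphere (0 : EuclideanSpace ℝ (Fin d)) 1).of_isClosed_subset ?_ ?_
      · have h1 : IsClosed {x : EuclideanSpace ℝ (Fin d) | ‖x‖ = 1} :=
          isClosed_eq continuous_norm continuous_const
        have h2 : IsClosed {x : EuclideanSpace ℝ (Fin d) | ∀ j, inner ℝ (w j) x = 0} := by
          have : {x : EuclideanSpace ℝ (Fin d) | ∀ j, inner ℝ (w j) x = 0}
              = ⋂ j, {x | inner ℝ (w j) x = 0} := by ext; simp
          rw [this]
          exact isClosed_iInter fun j => isClosed_eq (by fun_prop) continuous_const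
        exact R.closed_of_finiteDimensional.inter (h1.inter h2)
      · intro x hx
        simpa using hx.2.1
    · have h1 := (Submodule.span ℝ (Set.range w)).finrank_add_finrank_orthogonal
      have h2 : finrank ℝ (Submodule.span ℝ (Set.range w)) ≤ m := 
        (finrank_range_le_card (R := ℝ) w).trans_eq (Fintype.card_fin m)
      obtain ⟨x, hx, hx', hx1⟩ := exists_unit_mem_of_finrank_lt R
        (Submodule.span ℝ (Set.range w))ᗮ (by omega)
      refine ⟨x, hx, hx1, fun j => ?_⟩
      exact hx' _ (Submodule.subset_span ⟨j, rfl⟩)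
  obtain ⟨hcP, hnP⟩ := key P u hP
  obtain ⟨hcQ, hnQ⟩ := key Q v hQ
  obtain ⟨⟨x, y⟩, ⟨hx, hy⟩, hmax⟩ := (hcP.prod hcQ).exists_isMaxOn (hnP.prod hnQ)
    (f := fun p : EuclideanSpace ℝ (Fin d) × EuclideanSpace ℝ (Fin d) => inner ℝ p.1 p.2)
    (by fun_prop)
  exact ⟨x, hx.1, y, hy.1, hx.2.1, hy.2.1, hx.2.2, hy.2.2,
    fun x' hx' y' hy' h1 h2 h3 h4 => hmax (a := (x', y')) ⟨⟨hx', h1, h3⟩, ⟨hy', h2, h4⟩⟩⟩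

theorem exists_isPrincipalVectors {m : ℕ} (hP : m ≤ finrank ℝ P) (hQ : m ≤ finrank ℝ Q) :
    ∃ u v, IsPrincipalVectors m P Q u v := by
  induction m with
  | zero =>
    exact ⟨Fin.elim0, Fin.elim0, by constructor <;> exact fun i => i.elim0⟩
  | succ m ih =>
    obtain ⟨u, v, h⟩ := ih (by omega) (by omega)
    obtain ⟨x, hx, y, hy, hx1, hy1, hxo, hyo, hmax⟩ :=
      exists_isMax_inner (P := P) (Q := Q) (by omega) (by omega) u v
    refine ⟨Fin.snoc u x, Fin.snoc v y, ?_⟩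
    have horth : ∀ (w : Fin m → EuclideanSpace ℝ (Fin d)) (z : EuclideanSpace ℝ (Fin d)),
        (∀ i j, j < i → inner ℝ (w j) (w i) = 0) → (∀ j, inner ℝ (w j) z = 0) →
        ∀ i j, j < i → inner ℝ (Fin.snoc (α := fun _ => EuclideanSpace ℝ (Fin d)) w z j)
          (Fin.snoc (α := fun _ => EuclideanSpace ℝ (Fin d)) w z i) = 0 := by
      intro w z hw hz i j hij
      induction j using Fin.lastCases with
      | last => exact absurd hij (not_lt.2 (Fin.le_last i))
      | cast j =>
        induction i using Fin.lastCases with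
        | last => simpa using hz j
        | cast i => simpa using hw i j (Fin.castSucc_lt_castSucc_iff.1 hij)
    refine ⟨fun i => ?_, fun i => ?_, fun i => ?_, fun i => ?_, horth u x h.orth_left hxo,
      horth v y h.orth_right hyo, fun i x' hx' y' hy' hx1' hy1' hxo' hyo' => ?_⟩
    · induction i using Fin.lastCases with
      | last => simpa using hx
      | cast i => simpa using h.mem_left i
    · induction i using Fin.lastCases with
      | last => simpa using hy
      | cast i => simpa using h.mem_right i
    · induction i using Fin.lastCases with
      | last => simpa using hx1
      | cast i => simpa using h.norm_left i
    · induction i using Fin.lastCases with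
      | last => simpa using hy1
      | cast i => simpa using h.norm_right i
    · induction i using Fin.lastCases with
      | last =>
        simp only [Fin.snoc_last]
        exact hmax x' hx' y' hy' hx1' hy1'
          (fun j => by simpa using hxo' j.castSucc (Fin.castSucc_lt_last j))
          (fun j => by simpa using hyo' j.castSucc (Fin.castSucc_lt_last j))
      | cast i =>
        simp only [Fin.snoc_castSucc]
        exact h.isMax i x' hx' y' hy' hx1' hy1'
          (fun j hj => by simpa using hxo' j.castSucc (Fin.castSucc_lt_castSucc_iff.2 hj))
          (fun j hj => by simpa using hyo' j.castSucc (Fin.castSucc_lt_castSucc_iff.2 hj))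

/-- The Asimov distance is the angle of the last pair of principal vectors, which is determined by
stationarity (`v - ⟪u, v⟫ u ⟂ P` and `u - ⟪u, v⟫ v ⟂ Q`) and minimality. -/
theorem exists_asimovDist_eq_arccos (hk : 1 ≤ k) (hP : finrank ℝ P = k) (hQ : finrank ℝ Q = k) :
    ∃ u ∈ P, ∃ v ∈ Q, ‖u‖ = 1 ∧ ‖v‖ = 1 ∧ 0 ≤ inner ℝ u v ∧
      asimovDist k P Q = Real.arccos (inner ℝ u v) ∧
      (∀ x ∈ P, inner ℝ v x = inner ℝ u v * inner ℝ u x) ∧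
      (∀ y ∈ Q, inner ℝ u y = inner ℝ u v * inner ℝ v y) ∧
      (∀ y ∈ Q, ‖y‖ = 1 → ∃ x ∈ P, ‖x‖ = 1 ∧ inner ℝ u v ≤ inner ℝ x y) := by
  obtain ⟨u, v, h⟩ := exists_isPrincipalVectors (P := P) (Q := Q) hP.ge hQ.ge
  let l : Fin k := ⟨k - 1, by omega⟩
  have hl : ∀ i : Fin k, i ≤ l := fun i => Fin.le_def.2 (Nat.le_sub_one_of_lt i.2)
  have hmatch : ∀ y ∈ Q, ‖y‖ = 1 → ∃ x ∈ P, ‖x‖ = 1 ∧ inner ℝ (u l) (v l) ≤ inner ℝ x y :=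
    fun y hy hy1 => h.exists_le_inner hQ hy hy1 fun i => h.inner_antitone (hl i)
  refine ⟨u l, h.mem_left l, v l, h.mem_right l, h.norm_left l, h.norm_right l, h.inner_nonneg l,
    ?_, fun x hx => h.inner_left hP hx l, fun y hy => ?_, hmatch⟩
  · refine IsGreatest.csSup_eq ⟨⟨u, v, h, l, rfl⟩, ?_⟩
    rintro _ ⟨u', v', h', i, rfl⟩
    refine Real.arccos_le_arccos (le_trans ?_ (h'.inner_antitone (hl i)))
    obtain ⟨x, hx, hx1, hle⟩ := hmatch (v' l) (h'.mem_right l) (h'.norm_right l)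
    refine hle.trans ?_
    rw [real_inner_comm, h'.inner_left hP hx l]
    refine mul_le_of_le_one_right (h'.inner_nonneg l) ?_
    simpa [h'.norm_left l, hx1] using real_inner_le_norm (u' l) x
  · rw [h.symm.inner_left hQ hy l, real_inner_comm]

theorem IsPrincipalVectors.map {u v : Fin k → EuclideanSpace ℝ (Fin d)}
    (h : IsPrincipalVectors k P Q u v)
    (e : EuclideanSpace ℝ (Fin d) ≃ₗᵢ[ℝ] EuclideanSpace ℝ (Fin d)) :
    IsPrincipalVectors k (P.map e.toLinearEquiv.toLinearMap) (Q.map e.toLinearEquiv.toLinearMap)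
      (fun i => e (u i)) (fun i => e (v i)) where
  mem_left i := Submodule.mem_map_of_mem (h.mem_left i)
  mem_right i := Submodule.mem_map_of_mem (h.mem_right i)
  norm_left i := by rw [e.norm_map, h.norm_left]
  norm_right i := by rw [e.norm_map, h.norm_right]
  orth_left i j hij := by rw [e.inner_map_map, h.orth_left i j hij]
  orth_right i j hij := by rw [e.inner_map_map, h.orth_right i j hij]
  isMax := by
    rintro i _ ⟨x, hx, rfl⟩ _ ⟨y, hy, rfl⟩ hx1 hy1 hxo hyo
    simp only [LinearEquiv.coe_coe, LinearIsometryEquiv.coe_toLinearEquiv, e.norm_map,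
      e.inner_map_map] at *
    exact h.isMax i x hx y hy hx1 hy1 hxo hyo

/-- Rotating both subspaces does not change their Asimov distance. -/
theorem asimovDist_map (e : EuclideanSpace ℝ (Fin d) ≃ₗᵢ[ℝ] EuclideanSpace ℝ (Fin d)) :
    asimovDist k (P.map e.toLinearEquiv.toLinearMap) (Q.map e.toLinearEquiv.toLinearMap)
      = asimovDist k P Q := by
  have hback : ∀ R : Submodule ℝ (EuclideanSpace ℝ (Fin d)),
      (R.map e.toLinearEquiv.toLinearMap).map e.symm.toLinearEquiv.toLinearMap = R := by
    intro R
    rw [← Submodule.map_comp]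
    convert Submodule.map_id R
    ext x : 1
    simp
  unfold asimovDist
  congr 1
  ext θ
  constructor
  · rintro ⟨u, v, h, i, rfl⟩
    have h' := h.map e.symm
    rw [hback, hback] at h'
    exact ⟨_, _, h', i, by rw [e.symm.inner_map_map]⟩
  · rintro ⟨u, v, h, i, rfl⟩
    exact ⟨_, _, h.map e, i, by rw [e.inner_map_map]⟩

/-! ### Orthogonal changes of coordinates -/

section Orthogonal

variable {d n k : ℕ}

/-- The rotation `x ↦ U x` of `ℝᵈ` given by an orthogonal matrix `U`. -/
noncomputable def orthogonalIsometry (U : Matrix (Fin d) (Fin d) ℝ)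
    (hU : U ∈ Matrix.orthogonalGroup (Fin d) ℝ) :
    EuclideanSpace ℝ (Fin d) ≃ₗᵢ[ℝ] EuclideanSpace ℝ (Fin d) where
  toLinearEquiv := LinearEquiv.ofLinearMap (Matrix.toEuclideanLin U) (Matrix.toEuclideanLin Uᵀ)
    (by rw [← Matrix.toLpLin_mul_same,
          (Matrix.mem_orthogonalGroup_iff _ _).1 hU, Matrix.toLpLin_one])
    (by rw [← Matrix.toLpLin_mul_same,
          (Matrix.mem_orthogonalGroup_iff' _ _).1 hU, Matrix.toLpLin_one])
  norm_map' x := by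
    have h : ‖Matrix.toEuclideanLin U x‖ ^ 2 = ‖x‖ ^ 2 := by
      rw [← real_inner_self_eq_norm_sq, inner_toEuclideanLin, act, ← LinearMap.comp_apply,
        ← Matrix.toLpLin_mul_same,
        (Matrix.mem_orthogonalGroup_iff' _ _).1 hU, Matrix.toLpLin_one, LinearMap.id_apply,
        real_inner_self_eq_norm_sq]
    exact (sq_eq_sq₀ (norm_nonneg _) (norm_nonneg _)).1 h

theorem orthogonalIsometry_apply {U : Matrix (Fin d) (Fin d) ℝ}
    (hU : U ∈ Matrix.orthogonalGroup (Fin d) ℝ) (x : EuclideanSpace ℝ (Fin d)) :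
    orthogonalIsometry U hU x = Matrix.toEuclideanLin U x := rfl

theorem orthogonalIsometry_symm_apply {U : Matrix (Fin d) (Fin d) ℝ}
    (hU : U ∈ Matrix.orthogonalGroup (Fin d) ℝ) (x : EuclideanSpace ℝ (Fin d)) :
    (orthogonalIsometry U hU).symm x = Matrix.toEuclideanLin Uᵀ x := rfl

theorem norm_act_mul_mul_transpose {U : Matrix (Fin d) (Fin d) ℝ}
    (hU : U ∈ Matrix.orthogonalGroup (Fin d) ℝ) {V : Matrix (Fin n) (Fin n) ℝ}
    (hV : V ∈ Matrix.orthogonalGroup (Fin n) ℝ) (M : Matrix (Fin d) (Fin n) ℝ)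
    (x : EuclideanSpace ℝ (Fin d)) :
    ‖act (U * M * Vᵀ) x‖ = ‖act M ((orthogonalIsometry U hU).symm x)‖ := by
  rw [← (orthogonalIsometry V hV).norm_map (act M _), orthogonalIsometry_apply,
    orthogonalIsometry_symm_apply, act, act, Matrix.transpose_mul, Matrix.transpose_mul,
    Matrix.transpose_transpose, Matrix.toLpLin_mul_same, Matrix.toLpLin_mul_same]
  rfl

theorem gram_mul_mul_transpose {U : Matrix (Fin d) (Fin d) ℝ}
    {V : Matrix (Fin n) (Fin n) ℝ} (hV : V ∈ Matrix.orthogonalGroup (Fin n) ℝ)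
    (M : Matrix (Fin d) (Fin n) ℝ) :
    (U * M * Vᵀ) * (U * M * Vᵀ)ᵀ = U * (M * Mᵀ) * Uᵀ := by
  have h : Vᵀ * V = 1 := (Matrix.mem_orthogonalGroup_iff' _ _).1 hV
  simp only [Matrix.transpose_mul, Matrix.transpose_transpose, Matrix.mul_assoc]
  rw [← Matrix.mul_assoc Vᵀ V, h, Matrix.one_mul]

theorem sq_norm_eq_sum (B : Matrix (Fin d) (Fin n) ℝ) : ‖B‖ ^ 2 = ∑ i, ∑ j, B i j ^ 2 := by
  rw [Matrix.frobenius_norm_def, ← Real.sqrt_eq_rpow, Real.sq_sqrt (by positivity)]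
  simp

theorem sq_norm_eq_trace (B : Matrix (Fin d) (Fin n) ℝ) : ‖B‖ ^ 2 = (B * Bᵀ).trace := by
  rw [sq_norm_eq_sum]
  simp [Matrix.trace, Matrix.mul_apply, sq]

theorem norm_mul_mul_transpose {U : Matrix (Fin d) (Fin d) ℝ}
    (hU : U ∈ Matrix.orthogonalGroup (Fin d) ℝ) {V : Matrix (Fin n) (Fin n) ℝ}
    (hV : V ∈ Matrix.orthogonalGroup (Fin n) ℝ) (M : Matrix (Fin d) (Fin n) ℝ) :
    ‖U * M * Vᵀ‖ = ‖M‖ := by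
  rw [← sq_eq_sq₀ (norm_nonneg _) (norm_nonneg _), sq_norm_eq_trace, sq_norm_eq_trace,
    gram_mul_mul_transpose hV, Matrix.trace_mul_comm, ← Matrix.mul_assoc,
    (Matrix.mem_orthogonalGroup_iff' _ _).1 hU, Matrix.one_mul]

/-- The spectral gap expressed by `Separates` makes the leading subspace independent of how ties
among eigenvalues are broken, so that it rotates along with the matrix. -/
theorem pcaSubspace_mul_mul_transpose (hk : 1 ≤ k) (hkd : k < d)
    {U : Matrix (Fin d) (Fin d) ℝ} (hU : U ∈ Matrix.orthogonalGroup (Fin d) ℝ)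
    {V : Matrix (Fin n) (Fin n) ℝ} (hV : V ∈ Matrix.orthogonalGroup (Fin n) ℝ)
    {M : Matrix (Fin d) (Fin n) ℝ} {P : Submodule ℝ (EuclideanSpace ℝ (Fin d))}
    (hP : finrank ℝ P = k) (hM : Separates M P) :
    pcaSubspace k (U * M * Vᵀ)
      = (pcaSubspace k M).map (orthogonalIsometry U hU).toLinearEquiv.toLinearMap := by
  set e := orthogonalIsometry U hU with he
  symm
  refine Submodule.eq_of_le_of_finrank_eq ?_ ?_
  · rw [pcaSubspace, Submodule.map_span, Submodule.span_le]
    rintro _ ⟨_, ⟨i, hi, rfl⟩, rfl⟩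
    obtain ⟨x, hx, hx1, hxl⟩ := exists_sq_norm_act_le hk hkd M hP
    refine mem_pcaSubspace_of_gram_eq_smul (P := P.map e.toLinearEquiv.toLinearMap)
      (l := gramEigenvalues M i) hkd ?_ ?_ fun z hz hz1 => ?_
    · rw [LinearEquiv.finrank_map_eq, hP]
    · have h1 : Matrix.toEuclideanLin Uᵀ (Matrix.toEuclideanLin U (principalComponents M i))
          = principalComponents M i := e.symm_apply_apply _
      change Matrix.toEuclideanLin _ (Matrix.toEuclideanLin U _)
        = gramEigenvalues M i • Matrix.toEuclideanLin U _
      rw [gram_mul_mul_transpose hV, Matrix.toLpLin_mul_same, Matrix.toLpLin_mul_same,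
        LinearMap.comp_apply, LinearMap.comp_apply, h1, gram_principalComponents, map_smul]
    · rw [norm_act_mul_mul_transpose hU hV, ← he]
      have h1 : e.symm z ∈ Pᗮ := by
        intro y hy
        rw [← e.inner_map_map, e.apply_symm_apply]
        exact hz _ (Submodule.mem_map_of_mem hy)
      have h2 := hM x hx _ h1 hx1 (by rw [e.symm.norm_map, hz1])
      have h3 : gramEigenvalues M ⟨k - 1, Nat.sub_lt_of_lt hkd⟩ ≤ gramEigenvalues M i :=
        gramEigenvalues_antitone M (Fin.le_def.2 (Nat.le_sub_one_of_lt hi))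
      exact (pow_lt_pow_left₀ h2 (norm_nonneg _) two_ne_zero).trans_le (hxl.trans h3)
  · rw [LinearEquiv.finrank_map_eq, finrank_pcaSubspace hkd.le, finrank_pcaSubspace hkd.le]

end Orthogonal

/-! ### The diagonal matrix and its small perturbations -/

section Diagonal

variable {d n k : ℕ}

/-- The span of the first `k` coordinate axes. -/
def leadingSubspace (d k : ℕ) : Submodule ℝ (EuclideanSpace ℝ (Fin d)) :=
  Submodule.span ℝ (EuclideanSpace.basisFun (Fin d) ℝ '' {i : Fin d | (i : ℕ) < k})

theorem mem_leadingSubspace {x : EuclideanSpace ℝ (Fin d)} :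
    x ∈ leadingSubspace d k ↔ ∀ i : Fin d, k ≤ i → x i = 0 := by
  rw [leadingSubspace, mem_span_image_iff_inner]
  simp [EuclideanSpace.basisFun_apply, EuclideanSpace.inner_single_left]

theorem mem_leadingSubspace_orthogonal {x : EuclideanSpace ℝ (Fin d)} :
    x ∈ (leadingSubspace d k)ᗮ ↔ ∀ i : Fin d, (i : ℕ) < k → x i = 0 := by
  rw [leadingSubspace, mem_orthogonal_span_image]
  simp [EuclideanSpace.basisFun_apply, EuclideanSpace.inner_single_left]

theorem finrank_leadingSubspace (h : k ≤ d) : finrank ℝ (leadingSubspace d k) = k := by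
  rw [leadingSubspace, finrank_span_image, ncard_setOf_val_lt h]

theorem rectDiag_mul_transpose (hdn : d ≤ n) (σ : Fin d → ℝ) :
    rectDiag n σ * (rectDiag n σ)ᵀ = Matrix.diagonal fun i => σ i ^ 2 := by
  ext i i'
  rw [Matrix.mul_apply, Finset.sum_eq_single (Fin.castLE hdn i)]
  · by_cases h : i = i'
    · subst h; simp [rectDiag, sq]
    · have h' : (i' : ℕ) ≠ i := fun h2 => h (Fin.ext h2.symm)
      simp [rectDiag, Matrix.diagonal_apply_ne _ h, h']
  · intro j _ hj
    have : (i : ℕ) ≠ j := fun h => hj (Fin.ext h.symm)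
    simp [rectDiag, this]
  · simp

theorem inner_act_rectDiag (hdn : d ≤ n) (σ : Fin d → ℝ) (x y : EuclideanSpace ℝ (Fin d)) :
    inner ℝ (act (rectDiag n σ) x) (act (rectDiag n σ) y) = ∑ i, σ i ^ 2 * (x i * y i) := by
  rw [← inner_gram, rectDiag_mul_transpose hdn]
  simp only [PiLp.inner_apply, Matrix.toLpLin_apply, Matrix.mulVec_diagonal, RCLike.inner_apply,
    conj_trivial]
  exact Finset.sum_congr rfl fun i _ => by ring

theorem sq_norm_act_rectDiag (hdn : d ≤ n) (σ : Fin d → ℝ) (x : EuclideanSpace ℝ (Fin d)) :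
    ‖act (rectDiag n σ) x‖ ^ 2 = ∑ i, σ i ^ 2 * x i ^ 2 := by
  rw [← real_inner_self_eq_norm_sq, inner_act_rectDiag hdn]
  simp only [sq]

theorem sum_sq_eq_one {x : EuclideanSpace ℝ (Fin d)} (hx : ‖x‖ = 1) : ∑ i, x i ^ 2 = 1 := by
  have h := EuclideanSpace.real_norm_sq_eq x
  rw [hx] at h
  linarith

variable {σ : Fin d → ℝ}

theorem le_sq_norm_act_rectDiag (hσ : Antitone σ) (hσ0 : ∀ i, 0 ≤ σ i)
    (hdn : d ≤ n) (hkd : k < d)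
    {x : EuclideanSpace ℝ (Fin d)} (hx : x ∈ leadingSubspace d k) (hx1 : ‖x‖ = 1) :
    σ ⟨k - 1, Nat.sub_lt_of_lt hkd⟩ ^ 2 ≤ ‖act (rectDiag n σ) x‖ ^ 2 := by
  rw [mem_leadingSubspace] at hx
  rw [sq_norm_act_rectDiag hdn, ← mul_one (σ _ ^ 2), ← sum_sq_eq_one hx1, Finset.mul_sum]
  refine Finset.sum_le_sum fun i _ => ?_
  rcases lt_or_ge (i : ℕ) k with h | h
  · exact mul_le_mul_of_nonneg_right (pow_le_pow_left₀ (hσ0 _)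
      (hσ (Fin.le_def.2 (Nat.le_sub_one_of_lt h))) 2) (sq_nonneg _)
  · simp [hx i h]

theorem sq_norm_act_rectDiag_le (hσ : Antitone σ) (hσ0 : ∀ i, 0 ≤ σ i)
    (hdn : d ≤ n) (hkd : k < d)
    {z : EuclideanSpace ℝ (Fin d)} (hz : z ∈ (leadingSubspace d k)ᗮ) (hz1 : ‖z‖ = 1) :
    ‖act (rectDiag n σ) z‖ ^ 2 ≤ σ ⟨k, hkd⟩ ^ 2 := by
  rw [mem_leadingSubspace_orthogonal] at hz
  rw [sq_norm_act_rectDiag hdn, ← mul_one (σ ⟨k, hkd⟩ ^ 2), ← sum_sq_eq_one hz1, Finset.mul_sum]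
  refine Finset.sum_le_sum fun i _ => ?_
  rcases lt_or_ge (i : ℕ) k with h | h
  · simp [hz i h]
  · exact mul_le_mul_of_nonneg_right (pow_le_pow_left₀ (hσ0 _)
      (hσ (Fin.le_def.2 h)) 2) (sq_nonneg _)

theorem inner_act_rectDiag_eq_zero (hdn : d ≤ n) {x z : EuclideanSpace ℝ (Fin d)}
    (hx : x ∈ leadingSubspace d k) (hz : z ∈ (leadingSubspace d k)ᗮ) :
    inner ℝ (act (rectDiag n σ) x) (act (rectDiag n σ) z) = 0 := by
  rw [mem_leadingSubspace] at hx
  rw [mem_leadingSubspace_orthogonal] at hz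
  rw [inner_act_rectDiag hdn]
  refine Finset.sum_eq_zero fun i _ => ?_
  rcases lt_or_ge (i : ℕ) k with h | h
  · rw [hz i h]; ring
  · rw [hx i h]; ring

/-- Bessel's inequality, summed over the columns of `B`. -/
theorem sq_norm_act_add_sq_norm_act_le (B : Matrix (Fin d) (Fin n) ℝ)
    {x z : EuclideanSpace ℝ (Fin d)} (hx : ‖x‖ = 1) (hz : ‖z‖ = 1) (hxz : inner ℝ x z = 0) :
    ‖act B x‖ ^ 2 + ‖act B z‖ ^ 2 ≤ ‖B‖ ^ 2 := by
  rw [EuclideanSpace.real_norm_sq_eq, EuclideanSpace.real_norm_sq_eq, sq_norm_eq_sum,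
    Finset.sum_comm, ← Finset.sum_add_distrib]
  refine Finset.sum_le_sum fun j _ => ?_
  have hcol : ∀ y : EuclideanSpace ℝ (Fin d),
      act B y j = inner ℝ y (WithLp.toLp 2 fun i => B i j) := by
    intro y
    rw [act_apply]
    simp [PiLp.inner_apply]
  set w : EuclideanSpace ℝ (Fin d) := WithLp.toLp 2 fun i => B i j with hw
  have hnw : ∑ i, B i j ^ 2 = ‖w‖ ^ 2 := by rw [EuclideanSpace.real_norm_sq_eq]
  rw [hcol, hcol, hnw]
  have h := sq_nonneg ‖w - (inner ℝ x w • x + inner ℝ z w • z)‖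
  rw [norm_sub_sq_real, norm_add_sq_real, norm_smul, norm_smul, hx, hz] at h
  simp only [inner_add_right, inner_smul_left, inner_smul_right, hxz, real_inner_comm x w,
    real_inner_comm z w, conj_trivial, Real.norm_eq_abs, mul_one, sq_abs, mul_zero] at h
  nlinarith

/-- A perturbation of Frobenius norm less than `(σ_k - σ_{k+1}) / √2` keeps the leading and the
trailing coordinates separated: swapping the order at unit vectors `x`, `z` would require
`‖Bᵀ x‖ + ‖Bᵀ z‖ ≥ σ_k - σ_{k+1}`. -/
theorem separates_rectDiag_add (hσ : Antitone σ) (hσ0 : ∀ i, 0 ≤ σ i)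
    (hdn : d ≤ n) (hkd : k < d) {η : ℝ}
    (hη : η < (σ ⟨k - 1, Nat.sub_lt_of_lt hkd⟩ - σ ⟨k, hkd⟩) / √2)
    {B : Matrix (Fin d) (Fin n) ℝ} (hB : ‖B‖ ≤ η) :
    Separates (rectDiag n σ + B) (leadingSubspace d k) := by
  intro x hx z hz hx1 hz1
  by_contra! hle
  rw [act_add_left, act_add_left] at hle
  have h1 : σ ⟨k - 1, Nat.sub_lt_of_lt hkd⟩ ≤ ‖act (rectDiag n σ) x‖ :=
    (sq_le_sq₀ (hσ0 _) (norm_nonneg _)).1 (le_sq_norm_act_rectDiag hσ hσ0 hdn hkd hx hx1)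
  have h2 : ‖act (rectDiag n σ) z‖ ≤ σ ⟨k, hkd⟩ :=
    (sq_le_sq₀ (norm_nonneg _) (hσ0 _)).1 (sq_norm_act_rectDiag_le hσ hσ0 hdn hkd hz hz1)
  have h3 := norm_sub_norm_le (act (rectDiag n σ) x) (-act B x)
  rw [sub_neg_eq_add, norm_neg] at h3
  have h4 := norm_add_le (act (rectDiag n σ) z) (act B z)
  have h5 := sq_norm_act_add_sq_norm_act_le B hx1 hz1 (hz x hx)
  have h6 : η * √2 < σ ⟨k - 1, Nat.sub_lt_of_lt hkd⟩ - σ ⟨k, hkd⟩ :=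
    (lt_div_iff₀ (by positivity)).1 hη
  have h7 : ‖B‖ * √2 ≤ η * √2 := mul_le_mul_of_nonneg_right hB (by positivity)
  have h8 : (‖B‖ * √2) ^ 2 = 2 * ‖B‖ ^ 2 := by rw [mul_pow, Real.sq_sqrt zero_le_two]; ring
  have h9 : ‖B‖ * √2 < ‖act B x‖ + ‖act B z‖ := by linarith
  have h10 := pow_lt_pow_left₀ h9 (by positivity) two_ne_zero
  nlinarith [sq_nonneg (‖act B x‖ - ‖act B z‖)]

theorem pcaSubspace_rectDiag (hσ : Antitone σ) (hσ0 : ∀ i, 0 ≤ σ i)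
    (hdn : d ≤ n) (hkd : k < d)
    (hgap : σ ⟨k, hkd⟩ < σ ⟨k - 1, Nat.sub_lt_of_lt hkd⟩) :
    pcaSubspace k (rectDiag n σ) = leadingSubspace d k := by
  symm
  refine Submodule.eq_of_le_of_finrank_eq ?_
    ((finrank_leadingSubspace hkd.le).trans (finrank_pcaSubspace hkd.le _).symm)
  rw [leadingSubspace, Submodule.span_le]
  rintro _ ⟨i, hi, rfl⟩
  refine mem_pcaSubspace_of_gram_eq_smul (l := σ i ^ 2) hkd (finrank_leadingSubspace hkd.le) ?_
    fun z hz hz1 => ?_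
  · rw [rectDiag_mul_transpose hdn]
    ext j
    simp only [EuclideanSpace.basisFun_apply, Matrix.toLpLin_apply, Matrix.mulVec_diagonal,
      PiLp.smul_apply, smul_eq_mul, PiLp.single_apply]
    by_cases h : j = i
    · simp [h]
    · simp [h]
  · refine (sq_norm_act_rectDiag_le hσ hσ0 hdn hkd hz hz1).trans_lt
      (pow_lt_pow_left₀ (hgap.trans_le ?_) (hσ0 _) two_ne_zero)
    exact hσ (Fin.le_def.2 (Nat.le_sub_one_of_lt hi))

end Diagonal

/-! ### The cost of making two vectors equally long -/

section Cost

theorem sq_norm_sub_norm_le_two_mul {F : Type*} [SeminormedAddCommGroup F] {f₁ f₂ g₁ g₂ : F}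
    (h : ‖f₁ + g₁‖ = ‖f₂ + g₂‖) :
    (‖f₂‖ - ‖f₁‖) ^ 2 ≤ 2 * (‖g₁‖ ^ 2 + ‖g₂‖ ^ 2) := by
  have h1 : |‖f₁ + g₁‖ - ‖f₁‖| ≤ ‖g₁‖ := by simpa using abs_norm_sub_norm_le (f₁ + g₁) f₁
  have h2 : |‖f₂ + g₂‖ - ‖f₂‖| ≤ ‖g₂‖ := by simpa using abs_norm_sub_norm_le (f₂ + g₂) f₂
  have h3 := sq_le_sq' (neg_le_of_abs_le h1) (le_of_abs_le h1)
  have h4 := sq_le_sq' (neg_le_of_abs_le h2) (le_of_abs_le h2)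
  rw [h] at h3
  nlinarith [sq_nonneg (‖f₂ + g₂‖ - ‖f₁‖ + (‖f₂ + g₂‖ - ‖f₂‖))]

variable {F : Type*} [NormedAddCommGroup F] [InnerProductSpace ℝ F]

theorem exists_eq_smul_of_sq_norm_eq {f g : F} (hf : f ≠ 0)
    (h : ‖g‖ ^ 2 = (‖f + g‖ - ‖f‖) ^ 2) : ∃ t : ℝ, g = t • f := by
  have h1 : inner ℝ (f + g) f = ‖f + g‖ * ‖f‖ := by
    have h2 : ‖f + g - f‖ ^ 2 = ‖f + g‖ ^ 2 - 2 * inner ℝ (f + g) f + ‖f‖ ^ 2 :=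
      norm_sub_sq_real _ _
    rw [add_sub_cancel_left, h] at h2
    linarith
  rw [inner_eq_norm_mul_iff_real] at h1
  refine ⟨‖f‖⁻¹ * ‖f + g‖ - 1, ?_⟩
  rw [sub_smul, mul_smul, ← h1, one_smul, inv_smul_smul₀ (norm_ne_zero_iff.2 hf),
    add_sub_cancel_left]

/-- In the equality case of `sq_norm_sub_norm_le_two_mul` the vectors are only rescaled. -/
theorem exists_eq_smul_of_two_mul_le {f₁ f₂ g₁ g₂ : F} (hf₁ : f₁ ≠ 0) (hf₂ : f₂ ≠ 0)
    (h : ‖f₁ + g₁‖ = ‖f₂ + g₂‖) (heq : 2 * (‖g₁‖ ^ 2 + ‖g₂‖ ^ 2) ≤ (‖f₂‖ - ‖f₁‖) ^ 2) :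
    (∃ t : ℝ, g₁ = t • f₁) ∧ ∃ t : ℝ, g₂ = t • f₂ := by
  have h1 : |‖f₁ + g₁‖ - ‖f₁‖| ≤ ‖g₁‖ := by simpa using abs_norm_sub_norm_le (f₁ + g₁) f₁
  have h2 : |‖f₂ + g₂‖ - ‖f₂‖| ≤ ‖g₂‖ := by simpa using abs_norm_sub_norm_le (f₂ + g₂) f₂
  have h3 := sq_le_sq' (neg_le_of_abs_le h1) (le_of_abs_le h1)
  have h4 := sq_le_sq' (neg_le_of_abs_le h2) (le_of_abs_le h2)
  have h5 := sq_nonneg (‖f₂ + g₂‖ - ‖f₁‖ + (‖f₂ + g₂‖ - ‖f₂‖))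
  refine ⟨exists_eq_smul_of_sq_norm_eq hf₁ ?_, exists_eq_smul_of_sq_norm_eq hf₂ ?_⟩
  · rw [h] at h3 ⊢
    nlinarith
  · rw [h] at h3
    nlinarith

end Cost

/-! ### The extremal angle -/

/-- `sin² 2θ` for the largest angle `θ` that a perturbation of Frobenius norm `√(h / 2)` can reach
when the singular values at the gap are `a` and `b`. -/
noncomputable def extremalSinSq (a b h : ℝ) : ℝ :=
  h * (2 * (a ^ 2 + b ^ 2) - h) / (a ^ 2 - b ^ 2) ^ 2

/-- `cos θ` for the same angle `θ`, which is less than `π / 4`. -/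
noncomputable def extremalCos (a b h : ℝ) : ℝ := √((1 + √(1 - extremalSinSq a b h)) / 2)

section Extremal

variable {a b h : ℝ}

theorem extremalSinSq_lt_one (hb : 0 ≤ b) (hab : b < a) (hh : h < (a - b) ^ 2) :
    extremalSinSq a b h < 1 := by
  have hD : 0 < a ^ 2 - b ^ 2 := by nlinarith
  rw [extremalSinSq, div_lt_one (by positivity)]
  -- the difference factors as `((a - b) ^ 2 - h) * ((a + b) ^ 2 - h)`
  have h1 : 0 < ((a - b) ^ 2 - h) * ((a + b) ^ 2 - h) :=
    mul_pos (by linarith) (by nlinarith)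
  nlinarith

theorem extremalSinSq_nonneg (hb : 0 ≤ b) (hab : b < a) (hh0 : 0 ≤ h) (hh : h < (a - b) ^ 2) :
    0 ≤ extremalSinSq a b h :=
  div_nonneg (mul_nonneg hh0 (by nlinarith)) (sq_nonneg _)

theorem extremalCos_nonneg : 0 ≤ extremalCos a b h := Real.sqrt_nonneg _

theorem half_le_sq_extremalCos : 1 / 2 ≤ extremalCos a b h ^ 2 := by
  rw [extremalCos, Real.sq_sqrt (by positivity)]
  linarith [Real.sqrt_nonneg (1 - extremalSinSq a b h)]

theorem four_mul_sq_extremalCos (h1 : extremalSinSq a b h ≤ 1) :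
    4 * extremalCos a b h ^ 2 * (1 - extremalCos a b h ^ 2) = extremalSinSq a b h := by
  rw [extremalCos, Real.sq_sqrt (by positivity)]
  have := Real.sq_sqrt (sub_nonneg.2 h1)
  linear_combination -this

theorem extremalCos_le_one (h0 : 0 ≤ extremalSinSq a b h) : extremalCos a b h ≤ 1 := by
  rw [extremalCos, Real.sqrt_le_one]
  have : √(1 - extremalSinSq a b h) ≤ 1 := Real.sqrt_le_one.2 (by linarith)
  linarith

theorem extremalCos_le_of_le {c : ℝ} (hc : 0 ≤ c) (hc2 : 1 / 2 ≤ c ^ 2)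
    (h1 : extremalSinSq a b h ≤ 1) (hle : 4 * c ^ 2 * (1 - c ^ 2) ≤ extremalSinSq a b h) :
    extremalCos a b h ≤ c := by
  rw [← sq_le_sq₀ extremalCos_nonneg hc]
  rw [← four_mul_sq_extremalCos h1] at hle
  by_contra! hlt
  nlinarith [mul_pos (sub_pos.2 hlt) (show 0 < c ^ 2 + extremalCos a b h ^ 2 - 1 by linarith)]

/-- The extremal angle only decreases when the gap is widened. Here `x`, `y` are squared lengths
dominated by the gap `X`, `Y` of the squared singular values. -/
theorem gap_comparison {x y X Y : ℝ} (hy : 0 ≤ y) (hyY : y ≤ Y) (hYX : Y < X) (hXx : X ≤ x)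
    (hh : h ≤ X) :
    (2 * (x + y) - h) * (X - Y) ^ 2 ≤ (2 * (X + Y) - h) * (x - y) ^ 2 ∧
      ((2 * (X + Y) - h) * (x - y) ^ 2 ≤ (2 * (x + y) - h) * (X - Y) ^ 2 → x = X ∧ y = Y) := by
  obtain ⟨p, rfl⟩ : ∃ p, x = X + p := ⟨x - X, by ring⟩
  obtain ⟨q, rfl⟩ : ∃ q, Y = y + q := ⟨Y - y, by ring⟩
  obtain ⟨D, rfl⟩ : ∃ D, X = y + q + D := ⟨X - (y + q), by ring⟩
  have hp : 0 ≤ p := by linarith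
  have hq : 0 ≤ q := by linarith
  have hD : 0 < D := by linarith
  obtain ⟨r, rfl⟩ : ∃ r, h = y + q + D - r := ⟨y + q + D - h, by ring⟩
  have hr : 0 ≤ r := by linarith
  have key : (2 * (y + q + D + (y + q)) - (y + q + D - r)) * (y + q + D + p - y) ^ 2
      - (2 * (y + q + D + p + y) - (y + q + D - r)) * (y + q + D - (y + q)) ^ 2
      = D * p ^ 2 + 2 * q * D ^ 2 + (3 * (y + q) + r) * (q + p) * (2 * D + (q + p))
        + D * q * (2 * D + q + 2 * p) := by ring
  have hpos : 0 ≤ (3 * (y + q) + r) * (q + p) * (2 * D + (q + p)) := by positivity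
  have hpos2 : 0 ≤ D * q * (2 * D + q + 2 * p) := by positivity
  have hpos3 : 0 ≤ D * p ^ 2 := by positivity
  have hpos4 : 0 ≤ 2 * q * D ^ 2 := by positivity
  refine ⟨by linarith, fun hle => ?_⟩
  have h1 : D * p ^ 2 = 0 := by linarith
  have h2 : 2 * q * D ^ 2 = 0 := by linarith
  have hp0 : p = 0 := by
    rcases mul_eq_zero.1 h1 with h | h
    · exact absurd h hD.ne'
    · exact pow_eq_zero_iff two_ne_zero |>.1 h
  have hq0 : q = 0 := by
    rcases mul_eq_zero.1 h2 with h | h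
    · linarith
    · exact absurd h (by positivity)
  constructor <;> linarith

/-- Eliminating the lengths `r₁`, `r₂` from the bound `(r₂ - r₁)² ≤ 2h`. -/
theorem sin_sq_mul_le {c s x y r₁ r₂ : ℝ} (hsum : r₁ ^ 2 + r₂ ^ 2 = 2 * (x + y))
    (hdiff : r₂ ^ 2 - r₁ ^ 2 = 4 * (c * s) * (x - y)) (he : (r₂ - r₁) ^ 2 ≤ 2 * h)
    (hh : h < x + y) :
    4 * c ^ 2 * s ^ 2 * (x - y) ^ 2 ≤ h * (2 * (x + y) - h) ∧
      (h * (2 * (x + y) - h) ≤ 4 * c ^ 2 * s ^ 2 * (x - y) ^ 2 → 2 * h ≤ (r₂ - r₁) ^ 2) := by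
  have h1 : (r₂ ^ 2 - r₁ ^ 2) ^ 2 = (r₂ - r₁) ^ 2 * (4 * (x + y) - (r₂ - r₁) ^ 2) := by
    linear_combination 2 * (r₂ - r₁) ^ 2 * hsum
  rw [hdiff] at h1
  constructor
  · nlinarith [mul_nonneg (sub_nonneg.2 he)
      (show 0 ≤ 4 * (x + y) - (r₂ - r₁) ^ 2 - 2 * h by linarith)]
  · intro hle
    by_contra! hlt
    nlinarith [mul_pos (sub_pos.2 hlt)
      (show 0 < 4 * (x + y) - (r₂ - r₁) ^ 2 - 2 * h by linarith)]

/-- Any `c`, `s` subject to the bound with squared lengths `x`, `y` outside the gap have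
`c ≥ extremalCos a b h`, with equality only if the bound and both lengths are extremal. -/
theorem extremalCos_le_of_bound {c s x y : ℝ} (hb : 0 ≤ b) (hab : b < a) (hh0 : 0 ≤ h)
    (hh : h < (a - b) ^ 2) (hs : 0 ≤ s) (hsc : s < c) (hcs : c ^ 2 + s ^ 2 = 1) (hx : a ^ 2 ≤ x)
    (hy0 : 0 ≤ y) (hy : y ≤ b ^ 2)
    (hbound : 4 * c ^ 2 * s ^ 2 * (x - y) ^ 2 ≤ h * (2 * (x + y) - h)) :
    extremalCos a b h ≤ c ∧ (c = extremalCos a b h → 0 < h →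
      x = a ^ 2 ∧ y = b ^ 2 ∧ h * (2 * (x + y) - h) ≤ 4 * c ^ 2 * s ^ 2 * (x - y) ^ 2) := by
  have hab2 : b ^ 2 < a ^ 2 := pow_lt_pow_left₀ hab hb two_ne_zero
  have hha : h ≤ a ^ 2 := hh.le.trans (pow_le_pow_left₀ (by linarith) (by linarith) 2)
  have hle1 := extremalSinSq_lt_one hb hab hh
  obtain ⟨hcomp, hcomp'⟩ := gap_comparison hy0 hy hab2 hx hha
  have hxy : 0 < (x - y) ^ 2 := pow_pos (by linarith) 2
  have hD : 0 < (a ^ 2 - b ^ 2) ^ 2 := pow_pos (by linarith) 2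
  have hs2 : 1 - c ^ 2 = s ^ 2 := by linarith
  have hc2 : 1 / 2 ≤ c ^ 2 := by linarith [pow_le_pow_left₀ hs hsc.le 2]
  have hchain := mul_le_mul_of_nonneg_right hbound hD.le
  have hchain' := mul_le_mul_of_nonneg_left hcomp hh0
  refine ⟨extremalCos_le_of_le (hs.trans hsc.le) hc2 hle1.le ?_, fun heq hpos => ?_⟩
  · rw [hs2, extremalSinSq, le_div_iff₀ hD]
    refine le_of_mul_le_mul_right ?_ hxy
    linarith
  · have h1 := four_mul_sq_extremalCos hle1.le
    rw [← heq, hs2, extremalSinSq, eq_div_iff hD.ne'] at h1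
    have h2 : 4 * c ^ 2 * s ^ 2 * (x - y) ^ 2 * (a ^ 2 - b ^ 2) ^ 2
        = h * ((2 * (a ^ 2 + b ^ 2) - h) * (x - y) ^ 2) := by
      linear_combination (x - y) ^ 2 * h1
    obtain ⟨hX, hY⟩ := hcomp' (le_of_mul_le_mul_left (a := h) (by linarith) hpos)
    exact ⟨hX, hY, le_of_mul_le_mul_right (a := (a ^ 2 - b ^ 2) ^ 2) (by linarith) hD⟩

end Extremal

/-! ### The upper bound for the angle -/

section UpperBound

/-- The plane of the largest principal angle: `u, z` and `v, w` are two orthonormal bases of it,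
with `z ⟂ P` and `w ⟂ Q`. -/
theorem exists_rotation_of_inner_lt_one {E : Type*} [NormedAddCommGroup E] [InnerProductSpace ℝ E]
    {P Q : Submodule ℝ E} {u v : E} (hu1 : ‖u‖ = 1) (hv1 : ‖v‖ = 1) (hc0 : 0 ≤ inner ℝ u v)
    (hc1 : inner ℝ u v < 1) (hP : ∀ x ∈ P, inner ℝ v x = inner ℝ u v * inner ℝ u x)
    (hQ : ∀ y ∈ Q, inner ℝ u y = inner ℝ u v * inner ℝ v y) :
    ∃ s : ℝ, 0 < s ∧ inner ℝ u v ^ 2 + s ^ 2 = 1 ∧ ∃ z ∈ Pᗮ, ∃ w ∈ Qᗮ, ‖z‖ = 1 ∧ ‖w‖ = 1 ∧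
      v = inner ℝ u v • u + s • z ∧ w = inner ℝ u v • z - s • u := by
  set c := inner ℝ u v with hc
  have hs2 : 0 < 1 - c ^ 2 := by nlinarith
  refine ⟨√(1 - c ^ 2), Real.sqrt_pos.2 hs2, by rw [Real.sq_sqrt hs2.le]; ring, ?_⟩
  set s := √(1 - c ^ 2)
  have hs : 0 < s := Real.sqrt_pos.2 hs2
  have hss : s ^ 2 = 1 - c ^ 2 := Real.sq_sqrt hs2.le
  have hw : c • (s⁻¹ • (v - c • u)) - s • u = s⁻¹ • (c • v - u) := by
    rw [smul_comm, ← sub_eq_zero]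
    have : s • u = s⁻¹ • ((1 - c ^ 2) • u) := by
      rw [smul_smul, ← hss, sq, inv_mul_cancel_left₀ hs.ne']
    rw [this]
    module
  have hnorm : ∀ p q : E, ‖p‖ = 1 → ‖q‖ = 1 → inner ℝ p q = c → ‖s⁻¹ • (p - c • q)‖ = 1 := by
    intro p q hp hq hpq
    rw [← sq_eq_sq₀ (norm_nonneg _) zero_le_one, norm_smul, mul_pow, norm_sub_sq_real, norm_smul,
      inner_smul_right, hp, hq, hpq, norm_inv, Real.norm_eq_abs, Real.norm_eq_abs, mul_one, sq_abs,
      inv_pow, sq_abs, hss]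
    field_simp
    ring
  refine ⟨s⁻¹ • (v - c • u), fun x hx => ?_, _, fun y hy => ?_, ?_, ?_, ?_, rfl⟩
  · rw [real_inner_comm, inner_smul_left, inner_sub_left, inner_smul_left, hP x hx]
    simp
  · rw [hw, real_inner_comm, inner_smul_left, inner_sub_left, inner_smul_left, hQ y hy]
    simp
  · exact hnorm v u hv1 hu1 (by rw [real_inner_comm])
  · rw [hw, ← norm_neg, ← smul_neg, neg_sub]
    exact hnorm u v hu1 hv1 rfl
  · rw [smul_inv_smul₀ hs.ne', add_sub_cancel]

/-- A rotated pair `v, w` of the orthonormal pair `u, z` that reverses the order of the lengths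
under `T` has angle at least `π / 4`; here the order is kept. -/
theorem lt_of_norm_map_lt {E F : Type*} [AddCommGroup E] [Module ℝ E]
    [NormedAddCommGroup F] [InnerProductSpace ℝ F] (T : E →ₗ[ℝ] F) {u z v w : E} {c s : ℝ}
    (hc0 : 0 ≤ c) (hcs : c ^ 2 + s ^ 2 = 1) (hv : v = c • u + s • z) (hw : w = c • z - s • u)
    (hvw : inner ℝ (T v) (T w) = 0) (hle : ‖T w‖ ≤ ‖T v‖) (hlt : ‖T z‖ < ‖T u‖) : s < c := by
  by_contra! hsc
  have h1 : u = c • v - s • w := by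
    rw [hw, hv]
    linear_combination (norm := module) -(hcs • u)
  have h2 : z = s • v + c • w := by
    rw [hw, hv]
    linear_combination (norm := module) -(hcs • z)
  have h3 : ‖T u‖ ^ 2 = c ^ 2 * ‖T v‖ ^ 2 + s ^ 2 * ‖T w‖ ^ 2 := by
    rw [h1, map_sub, map_smul, map_smul, norm_sub_sq_real, norm_smul, norm_smul, inner_smul_left,
      inner_smul_right, hvw, mul_pow, mul_pow, Real.norm_eq_abs, Real.norm_eq_abs, sq_abs, sq_abs]
    ring
  have h4 : ‖T z‖ ^ 2 = s ^ 2 * ‖T v‖ ^ 2 + c ^ 2 * ‖T w‖ ^ 2 := by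
    rw [h2, map_add, map_smul, map_smul, norm_add_sq_real, norm_smul, norm_smul, inner_smul_left,
      inner_smul_right, hvw, mul_pow, mul_pow, Real.norm_eq_abs, Real.norm_eq_abs, sq_abs, sq_abs]
    ring
  have h5 := pow_lt_pow_left₀ hlt (norm_nonneg _) two_ne_zero
  have h6 := pow_le_pow_left₀ (norm_nonneg _) hle 2
  have h7 := pow_le_pow_left₀ hc0 hsc 2
  rw [h3, h4] at h5
  nlinarith [mul_nonneg (sub_nonneg.2 h6) (sub_nonneg.2 h7)]

/-- The bound in the plane: `α`, `β` are the images of `u`, `z` under `Σᵀ`, and `α'`, `β'` those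
under `Bᵀ`. The sum and the difference of the perturbed images of `v`, `w` are orthogonal
perturbations of `f₁`, `f₂` and have equal length. -/
theorem tilt_bound {F : Type*} [NormedAddCommGroup F] [InnerProductSpace ℝ F] {α β α' β' : F}
    {c s h : ℝ} (hs : 0 ≤ s) (hsc : s < c) (hcs : c ^ 2 + s ^ 2 = 1) (hα : α ≠ 0)
    (hαβ : inner ℝ α β = 0)
    (horth : inner ℝ (c • (α + α') + s • (β + β')) (c • (β + β') - s • (α + α')) = 0)
    (hE : 2 * (‖α'‖ ^ 2 + ‖β'‖ ^ 2) ≤ h) (hh : h < ‖α‖ ^ 2 + ‖β‖ ^ 2) :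
    4 * c ^ 2 * s ^ 2 * (‖α‖ ^ 2 - ‖β‖ ^ 2) ^ 2 ≤ h * (2 * (‖α‖ ^ 2 + ‖β‖ ^ 2) - h) ∧
      (h * (2 * (‖α‖ ^ 2 + ‖β‖ ^ 2) - h) ≤ 4 * c ^ 2 * s ^ 2 * (‖α‖ ^ 2 - ‖β‖ ^ 2) ^ 2 →
        h ≤ 2 * (‖α'‖ ^ 2 + ‖β'‖ ^ 2) ∧
          ∀ φ : F →ₗ[ℝ] ℝ, φ α = 0 → φ β = 0 → φ α' = 0 ∧ φ β' = 0) := by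
  obtain ⟨f₁, hf₁⟩ : ∃ f, f = (c - s) • α + (c + s) • β := ⟨_, rfl⟩
  obtain ⟨f₂, hf₂⟩ : ∃ f, f = (c + s) • α - (c - s) • β := ⟨_, rfl⟩
  obtain ⟨g₁, hg₁⟩ : ∃ f, f = (c - s) • α' + (c + s) • β' := ⟨_, rfl⟩
  obtain ⟨g₂, hg₂⟩ : ∃ f, f = (c + s) • α' - (c - s) • β' := ⟨_, rfl⟩
  have hequal : ‖f₁ + g₁‖ = ‖f₂ + g₂‖ := by
    have h1 : f₁ + g₁ = (c • (α + α') + s • (β + β')) + (c • (β + β') - s • (α + α')) := by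
      rw [hf₁, hg₁]; module
    have h2 : f₂ + g₂ = (c • (α + α') + s • (β + β')) - (c • (β + β') - s • (α + α')) := by
      rw [hf₂, hg₂]; module
    rw [h1, h2, ← sq_eq_sq₀ (norm_nonneg _) (norm_nonneg _),
      norm_add_sq_real (c • (α + α') + s • (β + β')),
      norm_sub_sq_real (c • (α + α') + s • (β + β')), horth]
    ring
  have hf1n : ‖f₁‖ ^ 2 = (c - s) ^ 2 * ‖α‖ ^ 2 + (c + s) ^ 2 * ‖β‖ ^ 2 := by
    rw [hf₁, norm_add_sq_real, norm_smul, norm_smul, inner_smul_left, inner_smul_right, hαβ,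
      mul_pow, mul_pow, Real.norm_eq_abs, Real.norm_eq_abs, sq_abs, sq_abs]
    ring
  have hf2n : ‖f₂‖ ^ 2 = (c + s) ^ 2 * ‖α‖ ^ 2 + (c - s) ^ 2 * ‖β‖ ^ 2 := by
    rw [hf₂, norm_sub_sq_real, norm_smul, norm_smul, inner_smul_left, inner_smul_right, hαβ,
      mul_pow, mul_pow, Real.norm_eq_abs, Real.norm_eq_abs, sq_abs, sq_abs]
    ring
  have hgn : ‖g₁‖ ^ 2 + ‖g₂‖ ^ 2 = 2 * (‖α'‖ ^ 2 + ‖β'‖ ^ 2) := by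
    rw [hg₁, hg₂, norm_add_sq_real, norm_sub_sq_real]
    simp only [norm_smul, inner_smul_left, inner_smul_right, mul_pow, Real.norm_eq_abs, sq_abs,
      conj_trivial]
    linear_combination (2 * (‖α'‖ ^ 2 + ‖β'‖ ^ 2)) * hcs
  have hcost := sq_norm_sub_norm_le_two_mul hequal
  have hsum : ‖f₁‖ ^ 2 + ‖f₂‖ ^ 2 = 2 * (‖α‖ ^ 2 + ‖β‖ ^ 2) := by
    rw [hf1n, hf2n]
    linear_combination (2 * (‖α‖ ^ 2 + ‖β‖ ^ 2)) * hcs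
  have hdiff : ‖f₂‖ ^ 2 - ‖f₁‖ ^ 2 = 4 * (c * s) * (‖α‖ ^ 2 - ‖β‖ ^ 2) := by
    rw [hf1n, hf2n]; ring
  obtain ⟨hbound, hbound'⟩ := sin_sq_mul_le hsum hdiff (h := h) (by linarith) hh
  refine ⟨hbound, fun hle => ?_⟩
  have h3 := hbound' hle
  have hα0 : 0 < ‖α‖ ^ 2 := by positivity
  have hf₁0 : f₁ ≠ 0 := by
    intro h0
    rw [h0, norm_zero] at hf1n
    have := mul_pos (pow_pos (sub_pos.2 hsc) 2) hα0
    have := mul_nonneg (sq_nonneg (c + s)) (sq_nonneg ‖β‖)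
    linarith
  have hf₂0 : f₂ ≠ 0 := by
    intro h0
    rw [h0, norm_zero] at hf2n
    have := mul_pos (pow_pos (show 0 < c + s by linarith) 2) hα0
    have := mul_nonneg (sq_nonneg (c - s)) (sq_nonneg ‖β‖)
    linarith
  obtain ⟨⟨t₁, ht₁⟩, t₂, ht₂⟩ := exists_eq_smul_of_two_mul_le hf₁0 hf₂0 hequal (by linarith)
  refine ⟨by linarith, fun φ hφ hφ' => ?_⟩
  have h4 : φ g₁ = 0 := by rw [ht₁, hf₁]; simp [hφ, hφ']
  have h5 : φ g₂ = 0 := by rw [ht₂, hf₂]; simp [hφ, hφ']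
  rw [hg₁] at h4
  rw [hg₂] at h5
  simp only [map_add, map_sub, map_smul, smul_eq_mul] at h4 h5
  constructor
  · linear_combination (c - s) / 2 * h4 + (c + s) / 2 * h5 - φ α' * hcs
  · linear_combination (c + s) / 2 * h4 - (c - s) / 2 * h5 - φ β' * hcs

variable {d n k : ℕ} {σ : Fin d → ℝ}

/-- The largest angle that a perturbation of norm at most `η` can reach, together with what
attaining it forces. The vectors `u`, `z` span the plane in which the leading subspace is tilted. -/
theorem exists_extremalCos_le (hσ : Antitone σ) (hσ0 : ∀ i, 0 ≤ σ i) (hdn : d ≤ n) (hk : 1 ≤ k)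
    (hkd : k < d) {η : ℝ} (hη0 : 0 ≤ η)
    (hη : η < (σ ⟨k - 1, Nat.sub_lt_of_lt hkd⟩ - σ ⟨k, hkd⟩) / √2)
    {B : Matrix (Fin d) (Fin n) ℝ} (hB : ‖B‖ ≤ η) :
    ∃ c ≤ 1, asimovDist k (leadingSubspace d k) (pcaSubspace k (rectDiag n σ + B)) = Real.arccos c ∧
      extremalCos (σ ⟨k - 1, Nat.sub_lt_of_lt hkd⟩) (σ ⟨k, hkd⟩) (2 * η ^ 2) ≤ c ∧
      (c = extremalCos (σ ⟨k - 1, Nat.sub_lt_of_lt hkd⟩) (σ ⟨k, hkd⟩) (2 * η ^ 2) → 0 < η →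
        ∃ u ∈ leadingSubspace d k, ∃ z ∈ (leadingSubspace d k)ᗮ, ‖u‖ = 1 ∧ ‖z‖ = 1 ∧
          ‖act (rectDiag n σ) u‖ ^ 2 = σ ⟨k - 1, Nat.sub_lt_of_lt hkd⟩ ^ 2 ∧
          ‖act (rectDiag n σ) z‖ ^ 2 = σ ⟨k, hkd⟩ ^ 2 ∧
          ‖B‖ ^ 2 ≤ ‖act B u‖ ^ 2 + ‖act B z‖ ^ 2 ∧
          ∀ j, act (rectDiag n σ) u j = 0 → act (rectDiag n σ) z j = 0 →
            act B u j = 0 ∧ act B z j = 0) := by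
  set a := σ ⟨k - 1, Nat.sub_lt_of_lt hkd⟩
  set b := σ ⟨k, hkd⟩
  have hb : 0 ≤ b := hσ0 _
  have hη2 : η * √2 < a - b := (lt_div_iff₀ (by positivity)).1 hη
  have hab : b < a := by nlinarith [mul_nonneg hη0 (Real.sqrt_nonneg 2)]
  have hh : 2 * η ^ 2 < (a - b) ^ 2 := by
    have h1 := pow_lt_pow_left₀ hη2 (by positivity) two_ne_zero
    rw [mul_pow, Real.sq_sqrt zero_le_two] at h1
    linarith
  have hle1 := extremalSinSq_lt_one hb hab hh
  have hge0 := extremalSinSq_nonneg hb hab (by positivity) hh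
  set M := rectDiag n σ + B
  set P := leadingSubspace d k
  set Q := pcaSubspace k M
  obtain ⟨u, hu, v, hv, hu1, hv1, hc0, hdist, hPs, hQs, -⟩ := exists_asimovDist_eq_arccos hk
    (finrank_leadingSubspace hkd.le) (finrank_pcaSubspace hkd.le M) (P := P) (Q := Q)
  have hc1 : inner ℝ u v ≤ 1 := by simpa [hu1, hv1] using real_inner_le_norm u v
  refine ⟨inner ℝ u v, hc1, hdist, ?_⟩
  rcases hc1.eq_or_lt with hc | hc
  · rw [hc]
    refine ⟨extremalCos_le_one hge0, fun h1 hη => ?_⟩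
    -- `η > 0` makes the extremal angle positive
    exfalso
    have h2 := four_mul_sq_extremalCos hle1.le
    rw [← h1, extremalSinSq] at h2
    have h3 : 0 < 2 * η ^ 2 * (2 * (a ^ 2 + b ^ 2) - 2 * η ^ 2) / (a ^ 2 - b ^ 2) ^ 2 := by
      have : 0 < a ^ 2 - b ^ 2 := by nlinarith
      refine div_pos (mul_pos (by positivity) (by nlinarith)) (by positivity)
    norm_num at h2
    linarith
  obtain ⟨s, hs, hcs, z, hz, w, hw, hz1, hw1, hvz, hwz⟩ :=
    exists_rotation_of_inner_lt_one hu1 hv1 hc0 hc hPs hQs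
  set c := inner ℝ u v
  have hMvw := inner_act_act_eq_zero hv hw
  have hMle := norm_act_le_norm_act hkd hv hw hv1 hw1
  have hsep := separates_rectDiag_add hσ hσ0 hdn hkd hη hB u hu z hz hu1 hz1
  have hA0 := inner_act_rectDiag_eq_zero (σ := σ) hdn hu hz
  have hx := le_sq_norm_act_rectDiag hσ hσ0 hdn hkd hu hu1
  have hy := sq_norm_act_rectDiag_le hσ hσ0 hdn hkd hz hz1
  have hE := sq_norm_act_add_sq_norm_act_le B hu1 hz1 (hz u hu)
  have hB2 : ‖B‖ ^ 2 ≤ η ^ 2 := pow_le_pow_left₀ (norm_nonneg _) hB 2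
  -- the angle is less than `π / 4`, because `M` still separates `P` from its complement
  have hsc : s < c := lt_of_norm_map_lt (act M) hc0 hcs hvz hwz hMvw hMle hsep
  rw [hvz, hwz, map_add, map_sub, map_smul, map_smul, map_smul, map_smul, act_add_left,
    act_add_left] at hMvw
  have hab2 : b ^ 2 < a ^ 2 := pow_lt_pow_left₀ hab hb two_ne_zero
  have hha : 2 * η ^ 2 < a ^ 2 :=
    hh.trans_le (pow_le_pow_left₀ (by linarith) (by linarith) 2)
  have hα0 : act (rectDiag n σ) u ≠ 0 := by
    intro h0
    rw [h0, norm_zero] at hx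
    linarith [sq_nonneg b]
  obtain ⟨hbound, hbound'⟩ := tilt_bound hs.le hsc hcs hα0 hA0 hMvw (h := 2 * η ^ 2)
    (by linarith) (by linarith [sq_nonneg ‖act (rectDiag n σ) z‖])
  obtain ⟨hcle, hceq⟩ := extremalCos_le_of_bound hb hab (by positivity) hh hs.le hsc hcs hx
    (sq_nonneg _) hy hbound
  refine ⟨hcle, fun heq hηpos => ?_⟩
  obtain ⟨hX, hY, hle⟩ := hceq heq (by positivity)
  obtain ⟨h3, h4⟩ := hbound' hle
  exact ⟨u, hu, z, hz, hu1, hz1, hX, hY, by linarith,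
    fun j hj hj' => h4 (EuclideanSpace.proj j).toLinearMap hj hj'⟩

end UpperBound

/-! ### A perturbation attaining the bound -/

section Attaining

/-- Rescaling `f₁ = (c - s) α + (c + s) β` and `f₂ = (c + s) α - (c - s) β` to the mean of their
lengths is the cheapest way to make them equally long. -/
theorem exists_plane_perturbation {F : Type*} [NormedAddCommGroup F] [InnerProductSpace ℝ F]
    {α β f₁ f₂ : F} {c s : ℝ} (hcs : c ^ 2 + s ^ 2 = 1)
    (hf₁ : f₁ = (c - s) • α + (c + s) • β) (hf₂ : f₂ = (c + s) • α - (c - s) • β)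
    (hf₁0 : f₁ ≠ 0) (hf₂0 : f₂ ≠ 0) :
    ∃ α' ∈ Submodule.span ℝ {α, β}, ∃ β' ∈ Submodule.span ℝ {α, β},
      4 * (‖α'‖ ^ 2 + ‖β'‖ ^ 2) = (‖f₂‖ - ‖f₁‖) ^ 2 ∧
      inner ℝ (c • (α + α') + s • (β + β')) (c • (β + β') - s • (α + α')) = 0 := by
  have hα : α ∈ Submodule.span ℝ {α, β} := Submodule.subset_span (by simp)
  have hβ : β ∈ Submodule.span ℝ {α, β} := Submodule.subset_span (by simp)
  have hn₁ : ‖f₁‖ ≠ 0 := norm_ne_zero_iff.2 hf₁0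
  have hn₂ : ‖f₂‖ ≠ 0 := norm_ne_zero_iff.2 hf₂0
  obtain ⟨ρ, hρ⟩ : ∃ ρ, ρ = (‖f₁‖ + ‖f₂‖) / 2 := ⟨_, rfl⟩
  have hmem : ∀ x y : ℝ, x • f₁ + y • f₂ ∈ Submodule.span ℝ {α, β} := by
    intro x y
    rw [hf₁, hf₂]
    exact add_mem (Submodule.smul_mem _ _ (add_mem (Submodule.smul_mem _ _ hα)
      (Submodule.smul_mem _ _ hβ))) (Submodule.smul_mem _ _ (sub_mem (Submodule.smul_mem _ _ hα)
      (Submodule.smul_mem _ _ hβ)))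
  obtain ⟨g₁, hg₁⟩ : ∃ g, g = (ρ / ‖f₁‖ - 1) • f₁ := ⟨_, rfl⟩
  obtain ⟨g₂, hg₂⟩ : ∃ g, g = (ρ / ‖f₂‖ - 1) • f₂ := ⟨_, rfl⟩
  have hg₁n : ‖g₁‖ ^ 2 = (ρ - ‖f₁‖) ^ 2 := by
    rw [hg₁, norm_smul, mul_pow, Real.norm_eq_abs, sq_abs, ← mul_pow, sub_mul,
      div_mul_cancel₀ _ hn₁, one_mul]
  have hg₂n : ‖g₂‖ ^ 2 = (ρ - ‖f₂‖) ^ 2 := by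
    rw [hg₂, norm_smul, mul_pow, Real.norm_eq_abs, sq_abs, ← mul_pow, sub_mul,
      div_mul_cancel₀ _ hn₂, one_mul]
  have hfg₁ : ‖f₁ + g₁‖ ^ 2 = ρ ^ 2 := by
    have : f₁ + g₁ = (ρ / ‖f₁‖) • f₁ := by rw [hg₁]; module
    rw [this, norm_smul, mul_pow, Real.norm_eq_abs, sq_abs, ← mul_pow, div_mul_cancel₀ _ hn₁]
  have hfg₂ : ‖f₂ + g₂‖ ^ 2 = ρ ^ 2 := by
    have : f₂ + g₂ = (ρ / ‖f₂‖) • f₂ := by rw [hg₂]; module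
    rw [this, norm_smul, mul_pow, Real.norm_eq_abs, sq_abs, ← mul_pow, div_mul_cancel₀ _ hn₂]
  obtain ⟨α', hα'⟩ : ∃ x, x = ((c - s) / 2) • g₁ + ((c + s) / 2) • g₂ := ⟨_, rfl⟩
  obtain ⟨β', hβ'⟩ : ∃ x, x = ((c + s) / 2) • g₁ - ((c - s) / 2) • g₂ := ⟨_, rfl⟩
  refine ⟨α', ?_, β', ?_, ?_, ?_⟩
  · rw [hα', hg₁, hg₂, smul_smul, smul_smul]; exact hmem _ _
  · rw [hβ', hg₁, hg₂, smul_smul, smul_smul, sub_eq_add_neg, ← neg_smul]; exact hmem _ _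
  · have h1 : 2 * (‖α'‖ ^ 2 + ‖β'‖ ^ 2) = ‖g₁‖ ^ 2 + ‖g₂‖ ^ 2 := by
      rw [hα', hβ', norm_add_sq_real, norm_sub_sq_real]
      simp only [norm_smul, inner_smul_left, inner_smul_right, mul_pow, Real.norm_eq_abs, sq_abs,
        conj_trivial]
      linear_combination (‖g₁‖ ^ 2 + ‖g₂‖ ^ 2) * hcs
    rw [hg₁n, hg₂n, hρ] at h1
    linear_combination 2 * h1
  · obtain ⟨x, hx⟩ : ∃ x, x = c • (α + α') + s • (β + β') := ⟨_, rfl⟩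
    obtain ⟨y, hy⟩ : ∃ y, y = c • (β + β') - s • (α + α') := ⟨_, rfl⟩
    have h1 : x + y = f₁ + g₁ := by
      rw [hx, hy, hf₁, hα', hβ']
      linear_combination (norm := module) hcs • g₁
    have h2 : x - y = f₂ + g₂ := by
      rw [hx, hy, hf₂, hα', hβ']
      linear_combination (norm := module) hcs • g₂
    rw [← hx, ← hy]
    rw [← h1, norm_add_sq_real] at hfg₁
    rw [← h2, norm_sub_sq_real] at hfg₂
    linarith

variable {d n k : ℕ} {σ : Fin d → ℝ}

/-- The matrix with rows `α`, `β` at the positions `i₀`, `i₁` and zero rows elsewhere. -/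
def twoRows (i₀ i₁ : Fin d) (α β : EuclideanSpace ℝ (Fin n)) : Matrix (Fin d) (Fin n) ℝ :=
  Matrix.of fun i j => if i = i₀ then α j else if i = i₁ then β j else 0

theorem act_twoRows {i₀ i₁ : Fin d} (h : i₀ ≠ i₁) (α β : EuclideanSpace ℝ (Fin n))
    (x : EuclideanSpace ℝ (Fin d)) : act (twoRows i₀ i₁ α β) x = x i₀ • α + x i₁ • β := by
  ext j
  rw [act_apply, Finset.sum_eq_add i₀ i₁ h]
  · simp [twoRows, h.symm, mul_comm]
  · intro i _ hi
    simp [twoRows, hi.1, hi.2]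
  · simp
  · simp

theorem sq_norm_twoRows {i₀ i₁ : Fin d} (h : i₀ ≠ i₁) (α β : EuclideanSpace ℝ (Fin n)) :
    ‖twoRows i₀ i₁ α β‖ ^ 2 = ‖α‖ ^ 2 + ‖β‖ ^ 2 := by
  rw [sq_norm_eq_sum, EuclideanSpace.real_norm_sq_eq, EuclideanSpace.real_norm_sq_eq,
    Finset.sum_eq_add i₀ i₁ h]
  · simp [twoRows, h.symm]
  · intro i _ hi
    simp [twoRows, hi.1, hi.2]
  · simp
  · simp

/-- If `y` is a vector of the second subspace whose matches in the first all have inner product at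
most `c`, then the Asimov distance is at least `arccos c`. -/
theorem arccos_le_asimovDist {P Q : Submodule ℝ (EuclideanSpace ℝ (Fin d))} (hk : 1 ≤ k)
    (hP : finrank ℝ P = k) (hQ : finrank ℝ Q = k) {y : EuclideanSpace ℝ (Fin d)} (hy : y ∈ Q)
    (hy1 : ‖y‖ = 1) {c : ℝ} (hc : ∀ x ∈ P, ‖x‖ = 1 → inner ℝ x y ≤ c) :
    Real.arccos c ≤ asimovDist k P Q := by
  obtain ⟨u, -, v, -, -, -, -, hdist, -, -, hmin⟩ := exists_asimovDist_eq_arccos hk hP hQ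
  obtain ⟨x, hx, hx1, hle⟩ := hmin y hy hy1
  rw [hdist]
  exact Real.arccos_le_arccos (hle.trans (hc x hx hx1))

/-- A rotation of `e₀`, `e₁` that makes the images of `v`, `w` orthogonal, while the images of
the other basis vectors are orthogonal to that of `v`, turns `v` into an eigenvector. -/
theorem gram_eq_smul_of_orthogonal {M : Matrix (Fin d) (Fin n) ℝ} {i₀ i₁ : Fin d} (hi : i₀ ≠ i₁)
    {v w : EuclideanSpace ℝ (Fin d)} {c s : ℝ} (hcs : c ^ 2 + s ^ 2 = 1)
    (hv : v = c • EuclideanSpace.single i₀ 1 + s • EuclideanSpace.single i₁ 1)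
    (hw : w = c • EuclideanSpace.single i₁ 1 - s • EuclideanSpace.single i₀ 1)
    (hvw : inner ℝ (act M v) (act M w) = 0)
    (hother : ∀ i, i ≠ i₀ → i ≠ i₁ →
      inner ℝ (act M v) (act M (EuclideanSpace.single i 1)) = 0) :
    Matrix.toEuclideanLin (M * Mᵀ) v = ‖act M v‖ ^ 2 • v := by
  have h0 : EuclideanSpace.single i₀ (1 : ℝ) = c • v - s • w := by
    rw [hw, hv]
    linear_combination (norm := module) -(hcs • EuclideanSpace.single i₀ (1 : ℝ))
  have h1 : EuclideanSpace.single i₁ (1 : ℝ) = s • v + c • w := by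
    rw [hw, hv]
    linear_combination (norm := module) -(hcs • EuclideanSpace.single i₁ (1 : ℝ))
  have hcoord : ∀ i, Matrix.toEuclideanLin (M * Mᵀ) v i
      = inner ℝ (act M v) (act M (EuclideanSpace.single i 1)) := by
    intro i
    rw [← inner_gram, EuclideanSpace.inner_single_right]
    simp
  have hv0 : v i₀ = c := by rw [hv]; simp [hi]
  have hv1 : v i₁ = s := by rw [hv]; simp [hi.symm]
  ext i
  rw [hcoord, PiLp.smul_apply, smul_eq_mul]
  by_cases hi0 : i = i₀
  · rw [hi0, hv0, h0, map_sub, map_smul, map_smul, inner_sub_right, inner_smul_right,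
      inner_smul_right, hvw, real_inner_self_eq_norm_sq]
    ring
  by_cases hi1 : i = i₁
  · rw [hi1, hv1, h1, map_add, map_smul, map_smul, inner_add_right, inner_smul_right,
      inner_smul_right, hvw, real_inner_self_eq_norm_sq]
    ring
  · rw [hother i hi0 hi1, hv]
    simp [hi0, hi1]

/-- The bound is attained inside the block: the `k`-th axis is tilted within the plane of the axes
`k` and `k + 1`, by the perturbation of `exists_plane_perturbation`. -/
theorem exists_supportedOnBlock_asimovDist_ge (hσ : Antitone σ) (hσ0 : ∀ i, 0 ≤ σ i)
    (hdn : d ≤ n) (hk : 1 ≤ k) (hkd : k < d) {η : ℝ} (hη0 : 0 ≤ η)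
    (hη : η < (σ ⟨k - 1, Nat.sub_lt_of_lt hkd⟩ - σ ⟨k, hkd⟩) / √2) :
    ∃ B : Matrix (Fin d) (Fin n) ℝ, ‖B‖ ≤ η ∧ SupportedOnBlock k B ∧
      Real.arccos (extremalCos (σ ⟨k - 1, Nat.sub_lt_of_lt hkd⟩) (σ ⟨k, hkd⟩) (2 * η ^ 2))
        ≤ asimovDist k (leadingSubspace d k) (pcaSubspace k (rectDiag n σ + B)) := by
  obtain ⟨i₀, hi₀⟩ : ∃ i : Fin d, i = ⟨k - 1, Nat.sub_lt_of_lt hkd⟩ := ⟨_, rfl⟩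
  obtain ⟨i₁, hi₁⟩ : ∃ i : Fin d, i = ⟨k, hkd⟩ := ⟨_, rfl⟩
  have hv₀ : (i₀ : ℕ) = k - 1 := by rw [hi₀]
  have hv₁ : (i₁ : ℕ) = k := by rw [hi₁]
  have hne : i₀ ≠ i₁ := fun h => by have := congrArg Fin.val h; omega
  have hsep := fun B (hB : ‖B‖ ≤ η) => separates_rectDiag_add hσ hσ0 hdn hkd hη hB
  rw [← hi₀, ← hi₁] at hη ⊢
  obtain ⟨a, ha⟩ : ∃ a, a = σ i₀ := ⟨_, rfl⟩
  obtain ⟨b, hb⟩ : ∃ b, b = σ i₁ := ⟨_, rfl⟩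
  rw [← ha, ← hb] at hη ⊢
  have hb0 : 0 ≤ b := hb ▸ hσ0 _
  have hη2 : η * √2 < a - b := (lt_div_iff₀ (by positivity)).1 hη
  have hab : b < a := by linarith [mul_nonneg hη0 (Real.sqrt_nonneg 2)]
  have hh : 2 * η ^ 2 < (a - b) ^ 2 := by
    have h1 := pow_lt_pow_left₀ hη2 (by positivity) two_ne_zero
    rw [mul_pow, Real.sq_sqrt zero_le_two] at h1
    linarith
  have hle1 := extremalSinSq_lt_one hb0 hab hh
  have hge0 := extremalSinSq_nonneg hb0 hab (by positivity) hh
  have hc4 := four_mul_sq_extremalCos hle1.le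
  have hc2 : 1 / 2 < extremalCos a b (2 * η ^ 2) ^ 2 := by
    refine lt_of_le_of_ne half_le_sq_extremalCos fun h => ?_
    rw [← h] at hc4
    linarith
  have hc0 : 0 ≤ extremalCos a b (2 * η ^ 2) := extremalCos_nonneg
  have hc1 := extremalCos_le_one hge0
  obtain ⟨c, hc⟩ : ∃ c, c = extremalCos a b (2 * η ^ 2) := ⟨_, rfl⟩
  rw [← hc] at hc4 hc2 hc0 hc1 ⊢
  obtain ⟨s, hs⟩ : ∃ s, s = √(1 - c ^ 2) := ⟨_, rfl⟩
  have hs0 : 0 ≤ s := hs ▸ Real.sqrt_nonneg _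
  have hs2 : s ^ 2 = 1 - c ^ 2 := by rw [hs, Real.sq_sqrt]; nlinarith
  have hcs : c ^ 2 + s ^ 2 = 1 := by linarith
  have hsc : s < c := by
    rw [← sq_lt_sq₀ hs0 hc0]; linarith
  have hD : 0 < a ^ 2 - b ^ 2 := by nlinarith
  rw [← hs2, extremalSinSq, eq_div_iff (by positivity)] at hc4
  -- the images of the two coordinate axes under `Σᵀ`
  set S := rectDiag n σ
  obtain ⟨e₀, he₀⟩ : ∃ e, e = EuclideanSpace.single i₀ (1 : ℝ) := ⟨_, rfl⟩
  obtain ⟨e₁, he₁⟩ : ∃ e, e = EuclideanSpace.single i₁ (1 : ℝ) := ⟨_, rfl⟩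
  have hα2 : ‖act S e₀‖ ^ 2 = a ^ 2 := by
    rw [sq_norm_act_rectDiag hdn, Finset.sum_eq_single i₀]
    · simp [he₀, ha]
    · intro i _ h; simp [he₀, h]
    · simp
  have hβ2 : ‖act S e₁‖ ^ 2 = b ^ 2 := by
    rw [sq_norm_act_rectDiag hdn, Finset.sum_eq_single i₁]
    · simp [he₁, hb]
    · intro i _ h; simp [he₁, h]
    · simp
  have hother : ∀ i i', i ≠ i' → inner ℝ (act S (EuclideanSpace.single i 1))
      (act S (EuclideanSpace.single i' 1)) = 0 := by
    intro i i' hii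
    rw [inner_act_rectDiag hdn]
    refine Finset.sum_eq_zero fun l _ => ?_
    by_cases h : l = i
    · subst h; simp [hii]
    · simp [h]
  have hαβ : inner ℝ (act S e₀) (act S e₁) = 0 := by rw [he₀, he₁]; exact hother _ _ hne
  obtain ⟨α, hα⟩ : ∃ α, α = act S e₀ := ⟨_, rfl⟩
  obtain ⟨β, hβ⟩ : ∃ β, β = act S e₁ := ⟨_, rfl⟩
  rw [← hα] at hα2 hαβ
  rw [← hβ] at hβ2 hαβ
  obtain ⟨f₁, hf₁⟩ : ∃ f, f = (c - s) • α + (c + s) • β := ⟨_, rfl⟩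
  obtain ⟨f₂, hf₂⟩ : ∃ f, f = (c + s) • α - (c - s) • β := ⟨_, rfl⟩
  have hf1n : ‖f₁‖ ^ 2 = (c - s) ^ 2 * a ^ 2 + (c + s) ^ 2 * b ^ 2 := by
    rw [hf₁, norm_add_sq_real, norm_smul, norm_smul, inner_smul_left, inner_smul_right, hαβ,
      mul_pow, mul_pow, Real.norm_eq_abs, Real.norm_eq_abs, sq_abs, sq_abs, hα2, hβ2]
    ring
  have hf2n : ‖f₂‖ ^ 2 = (c + s) ^ 2 * a ^ 2 + (c - s) ^ 2 * b ^ 2 := by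
    rw [hf₂, norm_sub_sq_real, norm_smul, norm_smul, inner_smul_left, inner_smul_right, hαβ,
      mul_pow, mul_pow, Real.norm_eq_abs, Real.norm_eq_abs, sq_abs, sq_abs, hα2, hβ2]
    ring
  have ha2 : 0 < a ^ 2 := pow_pos (by linarith) 2
  have hf₁0 : f₁ ≠ 0 := by
    intro h0
    rw [h0, norm_zero] at hf1n
    have := mul_pos (pow_pos (sub_pos.2 hsc) 2) ha2
    have := mul_nonneg (sq_nonneg (c + s)) (sq_nonneg b)
    linarith
  have hf₂0 : f₂ ≠ 0 := by
    intro h0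
    rw [h0, norm_zero] at hf2n
    have := mul_pos (pow_pos (show 0 < c + s by linarith) 2) ha2
    have := mul_nonneg (sq_nonneg (c - s)) (sq_nonneg b)
    linarith
  obtain ⟨α', hα', β', hβ', hcost, horth⟩ := exists_plane_perturbation hcs hf₁ hf₂ hf₁0 hf₂0
  -- the lengths of `f₁`, `f₂` differ by exactly `2η`
  have hdist : (‖f₂‖ - ‖f₁‖) ^ 2 = 4 * η ^ 2 := by
    have hsum : ‖f₁‖ ^ 2 + ‖f₂‖ ^ 2 = 2 * (a ^ 2 + b ^ 2) := by
      rw [hf1n, hf2n]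
      linear_combination (2 * (a ^ 2 + b ^ 2)) * hcs
    have hdiff : ‖f₂‖ ^ 2 - ‖f₁‖ ^ 2 = 4 * (c * s) * (a ^ 2 - b ^ 2) := by
      rw [hf1n, hf2n]; ring
    have hprod : ((‖f₂‖ - ‖f₁‖) ^ 2 - 4 * η ^ 2) *
        (4 * (a ^ 2 + b ^ 2) - (‖f₂‖ - ‖f₁‖) ^ 2 - 4 * η ^ 2) = 0 := by
      have h1 : (‖f₂‖ ^ 2 - ‖f₁‖ ^ 2) ^ 2 =
          (‖f₂‖ - ‖f₁‖) ^ 2 * (4 * (a ^ 2 + b ^ 2) - (‖f₂‖ - ‖f₁‖) ^ 2) := by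
        linear_combination 2 * (‖f₂‖ - ‖f₁‖) ^ 2 * hsum
      rw [hdiff] at h1
      linear_combination -h1 + 4 * hc4
    have hlt : 2 * η ^ 2 < a ^ 2 := hh.trans_le (pow_le_pow_left₀ (by linarith) (by linarith) 2)
    have hle : (‖f₂‖ - ‖f₁‖) ^ 2 ≤ 2 * (a ^ 2 + b ^ 2) := by
      rw [← hsum]
      linarith [mul_nonneg (norm_nonneg f₁) (norm_nonneg f₂), sub_sq ‖f₂‖ ‖f₁‖]
    rcases mul_eq_zero.1 hprod with h | h
    · linarith
    · linarith [sq_nonneg b]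
  obtain ⟨B, hB⟩ : ∃ B, B = twoRows i₀ i₁ α' β' := ⟨_, rfl⟩
  have hBn : ‖B‖ ≤ η := by
    rw [← sq_le_sq₀ (norm_nonneg _) hη0, hB, sq_norm_twoRows hne]
    linarith
  refine ⟨B, hBn, ?_, ?_⟩
  · -- `α` and `β` vanish outside the columns of the block
    have hker : ∀ j : Fin n, (j : ℕ) ≠ k - 1 → (j : ℕ) ≠ k → ∀ x ∈ Submodule.span ℝ {α, β},
        x j = 0 := by
      intro j hj hj' x hx
      obtain ⟨p, q, rfl⟩ := Submodule.mem_span_pair.1 hx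
      have hz : ∀ i : Fin d, (i : ℕ) ≠ j → act S (EuclideanSpace.single i 1) j = 0 := by
        intro i hij
        rw [act_apply, Finset.sum_eq_single i]
        · simp [S, rectDiag, hij]
        · intro l _ hl; simp [hl]
        · simp
      rw [PiLp.add_apply, PiLp.smul_apply, PiLp.smul_apply, hα, hβ, he₀, he₁, hz i₀ (by omega),
        hz i₁ (by omega)]
      simp
    intro i j hij
    constructor
    · by_contra! h
      refine hij ?_
      have h0 : i ≠ i₀ := fun h0 => by have := congrArg Fin.val h0; omega
      have h1 : i ≠ i₁ := fun h1 => by have := congrArg Fin.val h1; omega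
      simp [hB, twoRows, h0, h1]
    · by_contra! h
      refine hij ?_
      simp [hB, twoRows, hker j (by omega) (by omega) α' hα', hker j (by omega) (by omega) β' hβ']
  · have hP := finrank_leadingSubspace (d := d) hkd.le
    obtain ⟨v, hv⟩ : ∃ v, v = c • e₀ + s • e₁ := ⟨_, rfl⟩
    obtain ⟨w, hw⟩ : ∃ w, w = c • e₁ - s • e₀ := ⟨_, rfl⟩
    have hM₀ : act (S + B) e₀ = α + α' := by
      rw [act_add_left, hB, act_twoRows hne, hα, he₀]; simp [hne.symm]
    have hM₁ : act (S + B) e₁ = β + β' := by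
      rw [act_add_left, hB, act_twoRows hne, hβ, he₁]; simp [hne]
    have hMv : act (S + B) v = c • (α + α') + s • (β + β') := by
      rw [hv, map_add, map_smul, map_smul, hM₀, hM₁]
    have hMw : act (S + B) w = c • (β + β') - s • (α + α') := by
      rw [hw, map_sub, map_smul, map_smul, hM₀, hM₁]
    have hMvw : inner ℝ (act (S + B) v) (act (S + B) w) = 0 := by rw [hMv, hMw, horth]
    have hgram : Matrix.toEuclideanLin ((S + B) * (S + B)ᵀ) v = ‖act (S + B) v‖ ^ 2 • v := by
      refine gram_eq_smul_of_orthogonal hne hcs (he₀ ▸ he₁ ▸ hv) (he₀ ▸ he₁ ▸ hw) hMvw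
        fun i h0 h1 => ?_
      have hact : act (S + B) (EuclideanSpace.single i 1) = act S (EuclideanSpace.single i 1) := by
        rw [act_add_left, hB, act_twoRows hne]; simp [h0.symm, h1.symm]
      have hperp : ∀ x ∈ Submodule.span ℝ {α, β},
          inner ℝ x (act S (EuclideanSpace.single i 1)) = 0 := by
        intro x hx
        obtain ⟨p, q, rfl⟩ := Submodule.mem_span_pair.1 hx
        rw [inner_add_left, inner_smul_left, inner_smul_left, hα, hβ, he₀, he₁,
          hother i₀ i h0.symm, hother i₁ i h1.symm]
        simp
      have hα0 : α ∈ Submodule.span ℝ {α, β} := Submodule.subset_span (by simp)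
      have hβ0 : β ∈ Submodule.span ℝ {α, β} := Submodule.subset_span (by simp)
      rw [hact, hMv]
      exact hperp _ (add_mem (Submodule.smul_mem _ _ (add_mem hα0 hα'))
        (Submodule.smul_mem _ _ (add_mem hβ0 hβ')))
    have he₀P : e₀ ∈ leadingSubspace d k := by
      rw [mem_leadingSubspace]
      intro i hi
      have : i ≠ i₀ := fun h => by have := congrArg Fin.val h; omega
      simp [he₀, this]
    have he₁P : e₁ ∈ (leadingSubspace d k)ᗮ := by
      rw [mem_leadingSubspace_orthogonal]
      intro i hi
      have : i ≠ i₁ := fun h => by have := congrArg Fin.val h; omega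
      simp [he₁, this]
    have he₀1 : ‖e₀‖ = 1 := by simp [he₀]
    have he₁1 : ‖e₁‖ = 1 := by simp [he₁]
    have he01 : inner ℝ e₀ e₁ = 0 := he₁P e₀ he₀P
    have hv1 : ‖v‖ = 1 := by
      rw [← sq_eq_sq₀ (norm_nonneg _) zero_le_one, hv, norm_add_sq_real, norm_smul, norm_smul,
        inner_smul_left, inner_smul_right, he01, he₀1, he₁1, mul_one, mul_one, Real.norm_eq_abs,
        Real.norm_eq_abs, sq_abs, sq_abs]
      linarith
    -- `v` beats `e₀`, and `e₀` beats the complement of the leading coordinates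
    have hbeat : ‖act (S + B) e₀‖ ^ 2 ≤ ‖act (S + B) v‖ ^ 2 := by
      have h0 : e₀ = c • v - s • w := by
        rw [hw, hv]
        linear_combination (norm := module) -(hcs • e₀)
      have h1 : e₁ = s • v + c • w := by
        rw [hw, hv]
        linear_combination (norm := module) -(hcs • e₁)
      have h3 : ‖act (S + B) e₀‖ ^ 2
          = c ^ 2 * ‖act (S + B) v‖ ^ 2 + s ^ 2 * ‖act (S + B) w‖ ^ 2 := by
        rw [h0, map_sub, map_smul, map_smul, norm_sub_sq_real, norm_smul, norm_smul,
          inner_smul_left, inner_smul_right, hMvw, mul_pow, mul_pow, Real.norm_eq_abs,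
          Real.norm_eq_abs, sq_abs, sq_abs]
        ring
      have h4 : ‖act (S + B) e₁‖ ^ 2
          = s ^ 2 * ‖act (S + B) v‖ ^ 2 + c ^ 2 * ‖act (S + B) w‖ ^ 2 := by
        rw [h1, map_add, map_smul, map_smul, norm_add_sq_real, norm_smul, norm_smul,
          inner_smul_left, inner_smul_right, hMvw, mul_pow, mul_pow, Real.norm_eq_abs,
          Real.norm_eq_abs, sq_abs, sq_abs]
        ring
      have h5 := pow_lt_pow_left₀ (hsep B hBn e₀ he₀P e₁ he₁P he₀1 he₁1) (norm_nonneg _)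
        two_ne_zero
      rw [h3, h4] at h5
      have h6 : ‖act (S + B) w‖ ^ 2 < ‖act (S + B) v‖ ^ 2 := by
        by_contra! h
        have : 0 ≤ (c ^ 2 - s ^ 2) * (‖act (S + B) w‖ ^ 2 - ‖act (S + B) v‖ ^ 2) :=
          mul_nonneg (by linarith) (by linarith)
        linarith
      rw [h3]
      have := mul_le_mul_of_nonneg_left h6.le (sq_nonneg s)
      linear_combination this + ‖act (S + B) v‖ ^ 2 * hcs
    have hvQ : v ∈ pcaSubspace k (S + B) := by
      refine mem_pcaSubspace_of_gram_eq_smul hkd hP hgram fun z hz hz1 => ?_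
      exact (pow_lt_pow_left₀ (hsep B hBn e₀ he₀P z hz he₀1 hz1) (norm_nonneg _)
        two_ne_zero).trans_le hbeat
    refine arccos_le_asimovDist hk hP (finrank_pcaSubspace hkd.le _) hvQ hv1 fun x hx hx1 => ?_
    rw [hv, inner_add_right, inner_smul_right, inner_smul_right, he₁P x hx, mul_zero, add_zero]
    refine mul_le_of_le_one_right hc0 ?_
    simpa [hx1, he₀1] using real_inner_le_norm x e₀

end Attaining

/-! ### The two attack problems and the form of the optimal solutions -/

section Optimal

variable {d n k : ℕ} {σ : Fin d → ℝ}

theorem isOptimalAttack_mul_mul_transpose_iff (hσ : Antitone σ) (hσ0 : ∀ i, 0 ≤ σ i) (hdn : d ≤ n)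
    (hk : 1 ≤ k) (hkd : k < d) {η : ℝ} (hη0 : 0 ≤ η)
    (hη : η < (σ ⟨k - 1, Nat.sub_lt_of_lt hkd⟩ - σ ⟨k, hkd⟩) / √2)
    {U : Matrix (Fin d) (Fin d) ℝ} (hU : U ∈ Matrix.orthogonalGroup (Fin d) ℝ)
    {V : Matrix (Fin n) (Fin n) ℝ} (hV : V ∈ Matrix.orthogonalGroup (Fin n) ℝ)
    (D : Matrix (Fin d) (Fin n) ℝ) :
    IsOptimalAttack k η (U * rectDiag n σ * Vᵀ) D ↔
      IsOptimalAttack k η (rectDiag n σ) (Uᵀ * D * V) := by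
  have hback : ∀ E : Matrix (Fin d) (Fin n) ℝ, U * (Uᵀ * E * V) * Vᵀ = E := by
    intro E
    simp only [Matrix.mul_assoc]
    rw [(Matrix.mem_orthogonalGroup_iff _ _).1 hV, Matrix.mul_one, ← Matrix.mul_assoc,
      (Matrix.mem_orthogonalGroup_iff _ _).1 hU, Matrix.one_mul]
  have hforth : ∀ E : Matrix (Fin d) (Fin n) ℝ, Uᵀ * (U * E * Vᵀ) * V = E := by
    intro E
    simp only [Matrix.mul_assoc]
    rw [(Matrix.mem_orthogonalGroup_iff' _ _).1 hV, Matrix.mul_one, ← Matrix.mul_assoc,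
      (Matrix.mem_orthogonalGroup_iff' _ _).1 hU, Matrix.one_mul]
  have hnorm : ∀ E : Matrix (Fin d) (Fin n) ℝ, ‖Uᵀ * E * V‖ = ‖E‖ := by
    intro E
    rw [← norm_mul_mul_transpose hU hV (Uᵀ * E * V), hback]
  have hmap : ∀ E : Matrix (Fin d) (Fin n) ℝ, ‖E‖ ≤ η →
      pcaSubspace k (U * rectDiag n σ * Vᵀ + E)
        = (pcaSubspace k (rectDiag n σ + Uᵀ * E * V)).map
          (orthogonalIsometry U hU).toLinearEquiv.toLinearMap := by
    intro E hE
    rw [← pcaSubspace_mul_mul_transpose hk hkd hU hV (finrank_leadingSubspace hkd.le)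
      (separates_rectDiag_add hσ hσ0 hdn hkd hη ((hnorm E).trans_le hE)), Matrix.mul_add,
      Matrix.add_mul, hback]
  have hvalue : ∀ E : Matrix (Fin d) (Fin n) ℝ, ‖E‖ ≤ η →
      asimovDist k (pcaSubspace k (U * rectDiag n σ * Vᵀ))
          (pcaSubspace k (U * rectDiag n σ * Vᵀ + E))
        = asimovDist k (pcaSubspace k (rectDiag n σ))
          (pcaSubspace k (rectDiag n σ + Uᵀ * E * V)) := by
    intro E hE
    have h0 := hmap 0 (by simpa using hη0)
    rw [Matrix.mul_zero, Matrix.zero_mul, add_zero, add_zero] at h0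
    rw [hmap E hE, h0, asimovDist_map]
  constructor
  · rintro ⟨hmax, hD⟩
    refine ⟨fun E hE => ?_, (hnorm D).trans_le hD⟩
    have hE' : ‖U * E * Vᵀ‖ ≤ η := (norm_mul_mul_transpose hU hV E).trans_le hE
    have h := hmax hE'
    simp only [Set.mem_ofPred_eq] at h ⊢
    rwa [hvalue _ hE', hvalue D hD, hforth] at h
  · rintro ⟨hmax, hD⟩
    rw [hnorm] at hD
    refine ⟨fun E hE => ?_, hD⟩
    have h := hmax (a := Uᵀ * E * V) ((hnorm E).trans_le hE)
    simp only [Set.mem_ofPred_eq] at h ⊢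
    rwa [hvalue E hE, hvalue D hD]

theorem gap_pos_of_lt_div_sqrt {η a b : ℝ} (hη0 : 0 ≤ η) (hη : η < (a - b) / √2) : b < a := by
  have h : η * √2 < a - b := (lt_div_iff₀ (by positivity)).1 hη
  linarith [mul_nonneg hη0 (Real.sqrt_nonneg 2)]

theorem asimovDist_le_arccos_extremalCos (hσ : Antitone σ) (hσ0 : ∀ i, 0 ≤ σ i) (hdn : d ≤ n)
    (hk : 1 ≤ k) (hkd : k < d) {η : ℝ} (hη0 : 0 ≤ η)
    (hη : η < (σ ⟨k - 1, Nat.sub_lt_of_lt hkd⟩ - σ ⟨k, hkd⟩) / √2)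
    {B : Matrix (Fin d) (Fin n) ℝ} (hB : ‖B‖ ≤ η) :
    asimovDist k (leadingSubspace d k) (pcaSubspace k (rectDiag n σ + B))
      ≤ Real.arccos (extremalCos (σ ⟨k - 1, Nat.sub_lt_of_lt hkd⟩) (σ ⟨k, hkd⟩) (2 * η ^ 2)) := by
  obtain ⟨c, -, hdist, hle, -⟩ := exists_extremalCos_le hσ hσ0 hdn hk hkd hη0 hη hB
  rw [hdist]
  exact Real.arccos_le_arccos hle

theorem exists_isOptimalAttack_supportedOnBlock (hσ : Antitone σ) (hσ0 : ∀ i, 0 ≤ σ i)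
    (hdn : d ≤ n) (hk : 1 ≤ k) (hkd : k < d) {η : ℝ} (hη0 : 0 ≤ η)
    (hη : η < (σ ⟨k - 1, Nat.sub_lt_of_lt hkd⟩ - σ ⟨k, hkd⟩) / √2) :
    ∃ B : Matrix (Fin d) (Fin n) ℝ, IsOptimalAttack k η (rectDiag n σ) B ∧
      SupportedOnBlock k B := by
  obtain ⟨B, hB, hsupp, hge⟩ := exists_supportedOnBlock_asimovDist_ge hσ hσ0 hdn hk hkd hη0 hη
  refine ⟨B, ⟨fun E hE => ?_, hB⟩, hsupp⟩
  simp only [Set.mem_ofPred_eq]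
  rw [pcaSubspace_rectDiag hσ hσ0 hdn hkd (gap_pos_of_lt_div_sqrt hη0 hη)]
  exact (asimovDist_le_arccos_extremalCos hσ hσ0 hdn hk hkd hη0 hη hE).trans hge

/-- A unit vector at which a quadratic form `∑ τᵢ xᵢ²` takes an extreme value is supported where
`τ` takes that value. -/
theorem eq_zero_of_sum_mul_sq_eq {ι : Type*} [Fintype ι] {τ x : ι → ℝ} {t : ℝ}
    (hx : ∑ i, x i ^ 2 = 1) (ht : ∑ i, τ i * x i ^ 2 = t)
    (hsign : (∀ i, x i ≠ 0 → t ≤ τ i) ∨ ∀ i, x i ≠ 0 → τ i ≤ t) {i : ι} (hi : τ i ≠ t) :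
    x i = 0 := by
  have h0 : ∑ i, (τ i - t) * x i ^ 2 = 0 := by
    simp only [sub_mul, Finset.sum_sub_distrib, ← Finset.mul_sum, hx, ht]
    ring
  have h1 : (τ i - t) * x i ^ 2 = 0 := by
    rcases hsign with h | h
    · refine (Finset.sum_eq_zero_iff_of_nonneg fun j _ => ?_).1 h0 i (Finset.mem_univ i)
      by_cases hj : x j = 0
      · simp [hj]
      · exact mul_nonneg (sub_nonneg.2 (h j hj)) (sq_nonneg _)
    · refine (Finset.sum_eq_zero_iff_of_nonpos fun j _ => ?_).1 h0 i (Finset.mem_univ i)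
      by_cases hj : x j = 0
      · simp [hj]
      · exact mul_nonpos_of_nonpos_of_nonneg (sub_nonpos.2 (h j hj)) (sq_nonneg _)
  exact (pow_eq_zero_iff two_ne_zero).1 ((mul_eq_zero.1 h1).resolve_left (sub_ne_zero.2 hi))

theorem act_apply_of_support {i₀ : Fin d} {u : EuclideanSpace ℝ (Fin d)}
    (hu : ∀ i, i ≠ i₀ → u i = 0) (M : Matrix (Fin d) (Fin n) ℝ) (j : Fin n) :
    act M u j = M i₀ j * u i₀ := by
  rw [act_apply, Finset.sum_eq_single i₀]
  · intro i _ hi; rw [hu i hi, mul_zero]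
  · simp

theorem sq_norm_act_of_support {i₀ : Fin d} {u : EuclideanSpace ℝ (Fin d)}
    (hu : ∀ i, i ≠ i₀ → u i = 0) (hu1 : ‖u‖ = 1) (M : Matrix (Fin d) (Fin n) ℝ) :
    u i₀ ^ 2 = 1 ∧ ‖act M u‖ ^ 2 = ∑ j, M i₀ j ^ 2 := by
  have h1 : u i₀ ^ 2 = 1 := by
    rw [← sum_sq_eq_one hu1, Finset.sum_eq_single i₀]
    · intro i _ hi; rw [hu i hi, sq, mul_zero]
    · simp
  refine ⟨h1, ?_⟩
  rw [EuclideanSpace.real_norm_sq_eq]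
  simp only [act_apply_of_support hu, mul_pow, h1, mul_one]

/-- The equality case of the upper bound, when the singular values at the gap are not repeated. -/
theorem IsOptimalAttack.supportedOnBlock (hσ : Antitone σ) (hσ0 : ∀ i, 0 ≤ σ i)
    (hdn : d ≤ n) (hk : 1 ≤ k) (hkd : k < d) {η : ℝ} (hη0 : 0 ≤ η)
    (hη : η < (σ ⟨k - 1, Nat.sub_lt_of_lt hkd⟩ - σ ⟨k, hkd⟩) / √2)
    (hsimple : ∀ i : Fin d, (i : ℕ) ≠ k - 1 → (i : ℕ) ≠ k →
      σ i ≠ σ ⟨k - 1, Nat.sub_lt_of_lt hkd⟩ ∧ σ i ≠ σ ⟨k, hkd⟩)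
    {B : Matrix (Fin d) (Fin n) ℝ} (hB : IsOptimalAttack k η (rectDiag n σ) B) :
    SupportedOnBlock k B := by
  obtain ⟨hmax, hBη⟩ := hB
  rcases hη0.eq_or_lt with h0 | hηpos
  · have hB0 : B = 0 := norm_le_zero_iff.1 (hBη.trans_eq h0.symm)
    intro i j hij
    rw [hB0] at hij
    exact absurd rfl hij
  have hgap := gap_pos_of_lt_div_sqrt hη0 hη
  obtain ⟨B', hB', -, hge⟩ := exists_supportedOnBlock_asimovDist_ge hσ hσ0 hdn hk hkd hη0 hη
  obtain ⟨c, hc1, hdist, hle, hrigid⟩ := exists_extremalCos_le hσ hσ0 hdn hk hkd hη0 hη hBη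
  have hval := hmax hB'
  simp only [Set.mem_ofPred_eq] at hval
  rw [pcaSubspace_rectDiag hσ hσ0 hdn hkd hgap] at hval
  have harc := hge.trans hval
  rw [hdist] at harc
  have hc0 :=
    extremalCos_nonneg (a := σ ⟨k - 1, Nat.sub_lt_of_lt hkd⟩) (b := σ ⟨k, hkd⟩) (h := 2 * η ^ 2)
  have hceq : c = extremalCos (σ ⟨k - 1, Nat.sub_lt_of_lt hkd⟩) (σ ⟨k, hkd⟩) (2 * η ^ 2) :=
    Real.arccos_injOn ⟨by linarith, hc1⟩ ⟨by linarith, hle.trans hc1⟩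
      (le_antisymm (Real.arccos_le_arccos hle) harc)
  obtain ⟨u, hu, z, hz, hu1, hz1, hx, hy, hE, hker⟩ := hrigid hceq hηpos
  rw [sq_norm_act_rectDiag hdn] at hx hy
  rw [mem_leadingSubspace] at hu
  rw [mem_leadingSubspace_orthogonal] at hz
  have hinj : ∀ i j : Fin d, σ i ≠ σ j → σ i ^ 2 ≠ σ j ^ 2 := fun i j hij h =>
    hij ((sq_eq_sq₀ (hσ0 i) (hσ0 j)).1 h)
  -- simplicity of the two singular values leaves only the coordinate axes for `u` and `z`
  have hu' : ∀ i, i ≠ ⟨k - 1, Nat.sub_lt_of_lt hkd⟩ → u i = 0 := by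
    intro i hi
    have hi' : (i : ℕ) ≠ k - 1 := fun h => hi (Fin.ext h)
    by_cases hik : k ≤ i
    · exact hu i hik
    refine eq_zero_of_sum_mul_sq_eq (τ := fun i => σ i ^ 2) (sum_sq_eq_one hu1) hx (Or.inl ?_)
      (hinj _ _ (hsimple i hi' (by omega)).1)
    intro j hj
    refine pow_le_pow_left₀ (hσ0 _) (hσ (Fin.le_def.2 ?_)) 2
    by_contra! h
    exact hj (hu j (by simp only at h; omega))
  have hz' : ∀ i, i ≠ ⟨k, hkd⟩ → z i = 0 := by
    intro i hi
    have hi' : (i : ℕ) ≠ k := fun h => hi (Fin.ext h)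
    by_cases hik : (i : ℕ) < k
    · exact hz i hik
    refine eq_zero_of_sum_mul_sq_eq (τ := fun i => σ i ^ 2) (sum_sq_eq_one hz1) hy (Or.inr ?_)
      (hinj _ _ (hsimple i (by omega) hi').2)
    intro j hj
    refine pow_le_pow_left₀ (hσ0 _) (hσ (Fin.le_def.2 ?_)) 2
    by_contra! h
    exact hj (hz j h)
  obtain ⟨hu2, huB⟩ := sq_norm_act_of_support hu' hu1 B
  obtain ⟨hz2, hzB⟩ := sq_norm_act_of_support hz' hz1 B
  have hu0 : u ⟨k - 1, Nat.sub_lt_of_lt hkd⟩ ≠ 0 := fun h => by rw [h] at hu2; norm_num at hu2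
  have hz0 : z ⟨k, hkd⟩ ≠ 0 := fun h => by rw [h] at hz2; norm_num at hz2
  intro i j hij
  have hrow : (i : ℕ) + 1 = k ∨ (i : ℕ) + 1 = k + 1 := by
    by_contra! h
    have hne₀ : (⟨k - 1, Nat.sub_lt_of_lt hkd⟩ : Fin d) ≠ ⟨k, hkd⟩ := fun h => by
      have := congrArg Fin.val h; simp only at this; omega
    have hne₁ : i ≠ ⟨k - 1, Nat.sub_lt_of_lt hkd⟩ := fun h' => by
      have := congrArg Fin.val h'; simp only at this; omega
    have hne₂ : i ≠ ⟨k, hkd⟩ := fun h' => by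
      have := congrArg Fin.val h'; simp only at this; omega
    have hsum : ∑ l ∈ {i, ⟨k - 1, Nat.sub_lt_of_lt hkd⟩, ⟨k, hkd⟩}, ∑ j, B l j ^ 2 ≤ ‖B‖ ^ 2 := by
      rw [sq_norm_eq_sum]
      exact Finset.sum_le_univ_sum_of_nonneg fun l => Finset.sum_nonneg fun j _ => sq_nonneg _
    rw [Finset.sum_insert (by simp [hne₁, hne₂]), Finset.sum_pair hne₀, ← huB, ← hzB] at hsum
    have hle : B i j ^ 2 ≤ ∑ j, B i j ^ 2 :=
      Finset.single_le_sum (f := fun j => B i j ^ 2) (fun j _ => sq_nonneg _) (Finset.mem_univ j)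
    have : 0 < B i j ^ 2 := by positivity
    linarith
  refine ⟨hrow, ?_⟩
  by_contra! h
  have hcol : ∀ i : Fin d, (i : ℕ) ≠ j → rectDiag n σ i j = 0 := fun i hi => by
    simp [rectDiag, hi]
  obtain ⟨h1, h2⟩ := hker j
    (by rw [act_apply_of_support hu', hcol _ (by simp only; omega), zero_mul])
    (by rw [act_apply_of_support hz', hcol _ (by simp only; omega), zero_mul])
  rw [act_apply_of_support hu'] at h1
  rw [act_apply_of_support hz'] at h2
  rcases hrow with h' | h'
  · have : i = ⟨k - 1, Nat.sub_lt_of_lt hkd⟩ := Fin.ext (by simp only; omega)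
    exact hij (this ▸ (mul_eq_zero.1 h1).resolve_right hu0)
  · have : i = ⟨k, hkd⟩ := Fin.ext (by simp only; omega)
    exact hij (this ▸ (mul_eq_zero.1 h2).resolve_right hz0)

end Optimal

end SubspaceAttack

theorem theorem4 (d n k : ℕ) (hdn : d ≤ n) (hk : 1 ≤ k) (hkd : k < d)
    (σ : Fin d → ℝ) (hσ : Antitone σ) (hσ_nonneg : ∀ i, 0 ≤ σ i)
    (X : Matrix (Fin d) (Fin n) ℝ)
    (U : Matrix (Fin d) (Fin d) ℝ) (hU : U ∈ Matrix.orthogonalGroup (Fin d) ℝ)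
    (V : Matrix (Fin n) (Fin n) ℝ) (hV : V ∈ Matrix.orthogonalGroup (Fin n) ℝ)
    (hX : X = U * SubspaceAttack.rectDiag n σ * Vᵀ)
    (η : ℝ) (hη_nonneg : 0 ≤ η)
    (hη : η < (σ ⟨k - 1, by omega⟩ - σ ⟨k, hkd⟩) / √2) :
    -- the attack problem for `X` is the attack problem for `Σ` under `B = Uᵀ ΔX V`
    (∀ ΔX : Matrix (Fin d) (Fin n) ℝ,
      SubspaceAttack.IsOptimalAttack k η X ΔX ↔
        SubspaceAttack.IsOptimalAttack k η (SubspaceAttack.rectDiag n σ) (Uᵀ * ΔX * V)) ∧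
    -- some optimal `B` has the asserted form
    (∃ B : Matrix (Fin d) (Fin n) ℝ,
      SubspaceAttack.IsOptimalAttack k η (SubspaceAttack.rectDiag n σ) B ∧
        SubspaceAttack.SupportedOnBlock k B) ∧
    -- every optimal `B` has it, when `σ_k` and `σ_{k+1}` are not repeated
    ((∀ i : Fin d, (i : ℕ) ≠ k - 1 → (i : ℕ) ≠ k →
        σ i ≠ σ ⟨k - 1, by omega⟩ ∧ σ i ≠ σ ⟨k, hkd⟩) →
      ∀ B : Matrix (Fin d) (Fin n) ℝ,
        SubspaceAttack.IsOptimalAttack k η (SubspaceAttack.rectDiag n σ) B →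
          SubspaceAttack.SupportedOnBlock k B)
  := by
  subst hX
  exact ⟨SubspaceAttack.isOptimalAttack_mul_mul_transpose_iff hσ hσ_nonneg hdn hk hkd hη_nonneg hη
      hU hV,
    SubspaceAttack.exists_isOptimalAttack_supportedOnBlock hσ hσ_nonneg hdn hk hkd hη_nonneg hη,
    fun hsimple _ hB => hB.supportedOnBlock hσ hσ_nonneg hdn hk hkd hη_nonneg hη hsimple⟩
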